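/- Let $(\gamma_n)_{n\ge1}$ be a deterministic sequence in $(0,1)$, let $(\eta_{A,n})_{n\ge1}$ and $(\eta_{B,n})_{n\ge1}$ be deterministic sequences in $\{0,1\}$, let $x\in(0,1)$ and $\theta_A,\theta_B\in(0,1)$. Let $(I_n)_{n\ge1}$ be independent random variables, uniformly distributed on $[0,1]$, on a probability space $(\Omega,\mathcal F,\mathbb P)$. The Narendra two-armed bandit sequence $(X_n)_{n\ge0}$ is defined by $X_0=x$ and, for $n\ge0$, with $U_{n+1}=A$ if $I_{n+1}\le X_n$ and $U_{n+1}=B$ if $I_{n+1}>X_n$, $$X_{n+1}=\begin{cases}X_n+\gamma_{n+1}(1-X_n)&\text{if }U_{n+1}=A\text{ and }\eta_{A,n+1}=1,\\(1-\gamma_{n+1})X_n&\text{if }U_{n+1}=B\text{ and }\eta_{B,n+1}=1,\\X_n&\text{otherwise.}\end{cases}$$ Put $\Gamma_n=\sum_{k=1}^n\gamma_k$ and $R_n=\max_{\ell\in\{A,B\}}\left|\sum_{i=1}^n(\eta_{\ell,i}-\theta_\ell)\right|$. Theorem. Assume that - (S1) $(\gamma_n)_{n\ge1}$ is nonincreasing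 and $\Gamma_n\to\infty$ as $n\to\infty$; - (S2) $\gamma_n=O(\Gamma_n e^{-\theta_B\Gamma_n})$ as $n\to\infty$; - (E2) for some $\varepsilon>0$, $R_n/\phi(n)\to0$ as $n\to\infty$, where $\phi(n)=n/(\log(n+2))^{1+\varepsilon}$; - $\theta_A>\theta_B$. Then, $\mathbb P$-almost surely, $X_n\to1$ as $n\to\infty$ (the algorithm is infallible). -/

import Mathlib

open MeasureTheory ProbabilityTheory Filter Topology

/-- The two arms (sources) of the bandit. -/
inductive Arm : Type
  | A
  | B
  deriving DecidableEq

noncomputable section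

/-- Partial sums `Γ_n = ∑_{k=1}^n γ_k` of the step sequence. The value `γ 0` is never used. -/
def stepSum (γ : ℕ → ℝ) (n : ℕ) : ℝ := ∑ k ∈ Finset.Icc 1 n, γ k

/-- First step condition: `(γ_n)_{n ≥ 1}` is nonincreasing and `Γ_n → ∞`. -/
def StepCond1 (γ : ℕ → ℝ) : Prop :=
  AntitoneOn γ (Set.Ici 1) ∧ Tendsto (stepSum γ) atTop atTop

/-- Second step condition: `γ_n = O(Γ_n e^{-θ_B Γ_n})`. -/
def StepCond2 (γ : ℕ → ℝ) (θB : ℝ) : Prop :=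
  γ =O[atTop] fun n => stepSum γ n * Real.exp (-θB * stepSum γ n)

/-- `R_n = max_{ℓ ∈ {A, B}} |∑_{i=1}^n (η_{ℓ,i} - θ_ℓ)|`. -/
def payoffDeviation (η : Arm → ℕ → ℝ) (θ : Arm → ℝ) (n : ℕ) : ℝ :=
  max |∑ i ∈ Finset.Icc 1 n, (η Arm.A i - θ Arm.A)|
    |∑ i ∈ Finset.Icc 1 n, (η Arm.B i - θ Arm.B)|

/-- The ergodic condition with rate function `φ`: `R_n / φ(n) → 0`. -/
def ErgodicCond (η : Arm → ℕ → ℝ) (θ : Arm → ℝ) (φ : ℕ → ℝ) : Prop :=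
  Tendsto (fun n => payoffDeviation η θ n / φ n) atTop (𝓝 0)

/-- The ergodic condition with `φ(n) = n / (log (n + 2))^{1 + ε}` for some `ε > 0`. -/
def ErgodicCond2 (η : Arm → ℕ → ℝ) (θ : Arm → ℝ) : Prop :=
  ∃ ε : ℝ, 0 < ε ∧
    ErgodicCond η θ fun n => (n : ℝ) / (Real.log ((n : ℝ) + 2)) ^ (1 + ε)

/-- The arm played when the current state is `X` and the uniform variable takes the value `u`:
arm `A` if `u ≤ X`, arm `B` if `u > X`. -/
def armPlayed (u X : ℝ) : Arm := if u ≤ X then Arm.A else Arm.B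

/-- One step of the updating rule with step `g`, arm played `U` and payoffs `a` (of arm `A`)
and `b` (of arm `B`). -/
def narendraStep (g a b : ℝ) (U : Arm) (X : ℝ) : ℝ :=
  if U = Arm.A ∧ a = 1 then X + g * (1 - X)
  else if U = Arm.B ∧ b = 1 then (1 - g) * X
  else X

/-- The Narendra sequence `(X_n)_{n ≥ 0}` with step sequence `γ`, payoffs `η`, initial value `x`
and random input `u = (I_n)_{n ≥ 1}`. -/
def narendra (γ : ℕ → ℝ) (η : Arm → ℕ → ℝ) (x : ℝ) (u : ℕ → ℝ) : ℕ → ℝ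
  | 0 => x
  | n + 1 =>
    narendraStep (γ (n + 1)) (η Arm.A (n + 1)) (η Arm.B (n + 1))
      (armPlayed (u (n + 1)) (narendra γ η x u n)) (narendra γ η x u n)

end

/-! The mean increment of `X` is `γ X(1-X)(η_A - η_B)`, whose sign fluctuates. Let `r_n` be the tail
of the series `∑ γ_k (η_{A,k} - η_{B,k} - d)`, with `d = θ_A - θ_B`. The series converges by Abel
summation: (S2) forces `Γ_n = O(log n)`, which is just what the rate in (E2) can absorb. The
corrected state `X_n + r_n X_n(1-X_n)` then has mean increment at least `(d/2) γ X(1-X)` once `|r| ≤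
d/4`. So it is eventually a bounded submartingale. Since `Γ_n → ∞`, the limit of `X` can only be 0
or 1 (`ae_tendsto_zero_or_one`).

To exclude 0, an exponential of the corrected state, with parameter of order `1/γ_n`, is a
supermartingale from time `n` on. From a state `X_n ≥ γ_n` it bounds the conditional probability of
the limit 0 by a constant `q < 1`. By Lévy's 0-1 law the limit is 1 as soon as `X_n ≥ γ_n`
infinitely often (`ae_tendsto_one`).

A single success of arm A gives `X_{n+1} ≥ γ_{n+1}`, so infinitely many suffice. Even if B were
always played, `X_n ≥ c e^{-θ_B Γ_n}` (`exists_exp_le_narendra`). By (S2) and (E2) these bounds have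
infinite sum along the times when A pays, and Borel-Cantelli for the independent `I_n` concludes. -/

/-! ### Growth of `Γ_n` and square-summability of the steps -/

lemma stepSum_zero (γ : ℕ → ℝ) : stepSum γ 0 = 0 := by simp [stepSum]

lemma stepSum_succ (γ : ℕ → ℝ) (n : ℕ) : stepSum γ (n + 1) = stepSum γ n + γ (n + 1) := by
  rw [stepSum, stepSum, Finset.sum_Icc_succ_top (by omega)]

lemma stepSum_nonneg {γ : ℕ → ℝ} (hγ : ∀ n, 1 ≤ n → γ n ∈ Set.Ioo (0 : ℝ) 1) (n : ℕ) :
    0 ≤ stepSum γ n :=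
  Finset.sum_nonneg fun k hk => (hγ k (Finset.mem_Icc.1 hk).1).1.le

lemma stepSum_pos {γ : ℕ → ℝ} (hγ : ∀ n, 1 ≤ n → γ n ∈ Set.Ioo (0 : ℝ) 1) {n : ℕ} (hn : 1 ≤ n) :
    0 < stepSum γ n :=
  Finset.sum_pos (fun k hk => (hγ k (Finset.mem_Icc.1 hk).1).1) ⟨1, by simpa using hn⟩

lemma monotone_stepSum {γ : ℕ → ℝ} (hγ : ∀ n, 1 ≤ n → γ n ∈ Set.Ioo (0 : ℝ) 1) :
    Monotone (stepSum γ) := by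
  refine monotone_nat_of_le_succ fun n => ?_
  rw [stepSum_succ]
  linarith [(hγ (n + 1) (by omega)).1]

lemma nat_mul_le_stepSum {γ : ℕ → ℝ} (hS : AntitoneOn γ (Set.Ici 1)) (n : ℕ) :
    n * γ n ≤ stepSum γ n := by
  have h : ∑ _k ∈ Finset.Icc 1 n, γ n ≤ stepSum γ n := by
    refine Finset.sum_le_sum fun k hk => ?_
    rw [Finset.mem_Icc] at hk
    exact hS (Set.mem_Ici.2 hk.1) (Set.mem_Ici.2 (hk.1.trans hk.2)) hk.2
  simpa using h

/-- The second step condition as a bound valid for all `n ≥ 1`. -/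
lemma StepCond2.exists_bound {γ : ℕ → ℝ} {b : ℝ}
    (hγ : ∀ n, 1 ≤ n → γ n ∈ Set.Ioo (0 : ℝ) 1) (h : StepCond2 γ b) :
    ∃ C > 0, ∀ n, 1 ≤ n → γ n ≤ C * (stepSum γ n * Real.exp (-b * stepSum γ n)) := by
  obtain ⟨C, hC, hb⟩ := Asymptotics.bound_of_isBigO_nat_atTop h
  refine ⟨C, hC, fun n hn => ?_⟩
  have hp : 0 < stepSum γ n * Real.exp (-b * stepSum γ n) :=
    mul_pos (stepSum_pos hγ hn) (Real.exp_pos _)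
  have := hb hp.ne'
  rw [Real.norm_eq_abs, Real.norm_eq_abs, abs_of_pos hp] at this
  exact (le_abs_self _).trans this

/-- Half of the exponential rate absorbs the factor `Γ_n`, because `G ≤ (2/b) e^{bG/2}`. -/
lemma StepCond2.exists_exp_bound {γ : ℕ → ℝ} {b : ℝ} (hb : 0 < b)
    (hγ : ∀ n, 1 ≤ n → γ n ∈ Set.Ioo (0 : ℝ) 1) (h : StepCond2 γ b) :
    ∃ K > 0, ∀ n, 1 ≤ n → γ n ≤ K * Real.exp (-(b / 2) * stepSum γ n) := by
  obtain ⟨C, hC, h⟩ := h.exists_bound hγ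
  refine ⟨C * (2 / b), by positivity, fun n hn => (h n hn).trans ?_⟩
  set G := stepSum γ n
  have h1 : G ≤ 2 / b * Real.exp (b / 2 * G) := by
    have := Real.add_one_le_exp (b / 2 * G)
    calc G = 2 / b * (b / 2 * G) := by field_simp
      _ ≤ _ := by gcongr; linarith
  have h2 : Real.exp (-(b / 2) * G) = Real.exp (b / 2 * G) * Real.exp (-b * G) := by
    rw [← Real.exp_add]; ring_nf
  rw [h2]
  calc C * (G * Real.exp (-b * G)) ≤ C * (2 / b * Real.exp (b / 2 * G) * Real.exp (-b * G)) := by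
        gcongr
    _ = _ := by ring

section ExpBound

variable {γ : ℕ → ℝ} {a K : ℝ} (hγ : ∀ n, 1 ≤ n → γ n ∈ Set.Ioo (0 : ℝ) 1) (ha : 0 < a)
  (hK : 0 < K) (hb : ∀ n, 1 ≤ n → γ n ≤ K * Real.exp (-a * stepSum γ n))
include ha hb

/-- Each step adds at most `aK`: the bound on `γ` gives `γ_{n+1} e^{aΓ_{n+1}} ≤ K`, and `e^{-t} ≥ 1
- t` bounds the increment by `a` times this. Hence `Γ_n = O(log n)`. -/
lemma exp_stepSum_le (n : ℕ) : Real.exp (a * stepSum γ n) ≤ 1 + a * K * n := by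
  induction n with
  | zero => simp [stepSum_zero]
  | succ n ih =>
    have h1 := hb (n + 1) (by omega)
    have h2 : Real.exp (a * stepSum γ n)
        = Real.exp (a * stepSum γ (n + 1)) * Real.exp (-(a * γ (n + 1))) := by
      rw [← Real.exp_add, stepSum_succ]; ring_nf
    have h3 := Real.add_one_le_exp (-(a * γ (n + 1)))
    have h4 : Real.exp (a * stepSum γ (n + 1)) * γ (n + 1) ≤ K := by
      calc _ ≤ Real.exp (a * stepSum γ (n + 1)) *
            (K * Real.exp (-a * stepSum γ (n + 1))) := by gcongr
        _ = K * Real.exp (a * stepSum γ (n + 1) + -a * stepSum γ (n + 1)) := by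
          rw [Real.exp_add]; ring
        _ = K := by simp
    have h5 := mul_le_mul_of_nonneg_left h3 (Real.exp_pos (a * stepSum γ (n + 1))).le
    push_cast
    nlinarith

include hK in
lemma exists_stepSum_le_log : ∃ C > 0, ∀ n : ℕ, 1 + stepSum γ n ≤ C * Real.log (n + 2) := by
  have hl2 := Real.log_pos one_lt_two
  have hl : 0 ≤ Real.log (1 + a * K) := Real.log_nonneg (by nlinarith [mul_pos ha hK])
  refine ⟨(a + (Real.log (1 + a * K)) + Real.log 2) / (a * Real.log 2), by positivity,
    fun n => ?_⟩
  have hn : (0 : ℝ) ≤ n := n.cast_nonneg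
  have h1 : a * stepSum γ n ≤ Real.log (1 + a * K) + Real.log (n + 2) := by
    rw [← Real.log_mul (by positivity) (by positivity), Real.le_log_iff_exp_le (by positivity)]
    refine (exp_stepSum_le ha hb n).trans ?_
    nlinarith [mul_pos ha hK]
  have h2 : Real.log 2 ≤ Real.log (n + 2) := Real.log_le_log (by norm_num) (by linarith)
  rw [div_mul_eq_mul_div, le_div_iff₀ (by positivity)]
  nlinarith [mul_le_mul_of_nonneg_left h2 hl, mul_le_mul_of_nonneg_left h2 ha.le,
    mul_le_mul_of_nonneg_right h1 hl2.le]

include hγ hK in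
-- The sum telescopes: `γ_k² ≤ K γ_k e^{-aΓ_k} ≤ (K/a)(e^{-aΓ_{k-1}} - e^{-aΓ_k})`.
lemma sum_sq_step_le (n : ℕ) : ∑ k ∈ Finset.Icc 1 n, γ k ^ 2 ≤ K / a := by
  suffices h : ∑ k ∈ Finset.Icc 1 n, γ k ^ 2 ≤ K / a * (1 - Real.exp (-a * stepSum γ n)) by
    refine h.trans ?_
    have : 0 < K / a := by positivity
    nlinarith [Real.exp_pos (-a * stepSum γ n)]
  induction n with
  | zero => simp [stepSum_zero]
  | succ n ih =>
    rw [Finset.sum_Icc_succ_top (by omega)]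
    have hp := (hγ (n + 1) (by omega)).1
    have h1 := hb (n + 1) (by omega)
    have h2 : Real.exp (-a * stepSum γ n)
        = Real.exp (-a * stepSum γ (n + 1)) * Real.exp (a * γ (n + 1)) := by
      rw [← Real.exp_add, stepSum_succ]; ring_nf
    have h3 := Real.add_one_le_exp (a * γ (n + 1))
    have h4 : γ (n + 1) ^ 2 ≤ K / a * (Real.exp (-a * stepSum γ n)
        - Real.exp (-a * stepSum γ (n + 1))) := by
      rw [h2]
      set E := Real.exp (-a * stepSum γ (n + 1))
      have hE : 0 < E := Real.exp_pos _
      calc γ (n + 1) ^ 2 ≤ K * E * γ (n + 1) := by rw [sq]; gcongr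
        _ = K / a * (E * (a * γ (n + 1))) := by field_simp
        _ ≤ K / a * (E * (Real.exp (a * γ (n + 1)) - 1)) := by gcongr; linarith
        _ = _ := by ring
    linarith

end ExpBound

/-! ### Convergence of the step-weighted payoff deviations -/

/-- A discrete form of `∫₁^∞ u^{-1-ε} du = 1/ε`: each term is at most `1/ε` times the decrease of
`(1+Γ)^{-ε}`, by the Bernoulli-type bound `(1-t)^{-ε} ≥ 1 + εt`. -/
lemma sum_step_div_rpow_le {γ : ℕ → ℝ} (hγ : ∀ n, 1 ≤ n → γ n ∈ Set.Ioo (0 : ℝ) 1) {ε : ℝ}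
    (hε : 0 < ε) (n : ℕ) :
    ∑ k ∈ Finset.Icc 1 n, γ k / (1 + stepSum γ k) ^ (1 + ε) ≤ 1 / ε := by
  suffices h : ∑ k ∈ Finset.Icc 1 n, γ k / (1 + stepSum γ k) ^ (1 + ε)
      ≤ 1 / ε * (1 - (1 + stepSum γ n) ^ (-ε)) by
    refine h.trans ?_
    have h1 : 0 < 1 / ε := by positivity
    have h2 : 0 ≤ (1 + stepSum γ n) ^ (-ε) :=
      Real.rpow_nonneg (by linarith [stepSum_nonneg hγ n]) _
    nlinarith
  induction n with
  | zero => simp [stepSum_zero]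
  | succ n ih =>
    rw [Finset.sum_Icc_succ_top (by omega)]
    have hp := (hγ (n + 1) (by omega)).1
    have hG := stepSum_nonneg hγ n
    have hu : 0 < 1 + stepSum γ (n + 1) := by linarith [stepSum_nonneg hγ (n + 1)]
    set u := 1 + stepSum γ (n + 1) with hu'
    set g := γ (n + 1)
    have hv : 1 + stepSum γ n = u * (1 - g / u) := by
      rw [mul_sub, mul_div_cancel₀ _ hu.ne', hu', stepSum_succ]; ring
    have ht : 0 < 1 - g / u := by
      have : 0 < u * (1 - g / u) := by rw [← hv]; linarith
      exact pos_of_mul_pos_right this hu.le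
    have h1 : 1 + ε * (g / u) ≤ (1 - g / u) ^ (-ε) := by
      rw [Real.rpow_def_of_pos ht]
      have h2 := Real.log_le_sub_one_of_pos ht
      have h3 := Real.add_one_le_exp (Real.log (1 - g / u) * -ε)
      nlinarith
    have h4 : (1 + stepSum γ n) ^ (-ε) = u ^ (-ε) * (1 - g / u) ^ (-ε) := by
      rw [hv, Real.mul_rpow hu.le ht.le]
    have h5 : g / u ^ (1 + ε) = u ^ (-ε) * (g / u) := by
      rw [Real.rpow_add hu, Real.rpow_one, Real.rpow_neg hu.le]
      field_simp
    have h6 : 0 < u ^ (-ε) := Real.rpow_pos_of_pos hu _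
    have h7 : g / u ^ (1 + ε) ≤ 1 / ε * ((1 + stepSum γ n) ^ (-ε) - u ^ (-ε)) := by
      rw [h5, h4]
      calc u ^ (-ε) * (g / u) = 1 / ε * (u ^ (-ε) * (1 + ε * (g / u)) - u ^ (-ε)) := by
            field_simp; ring
        _ ≤ _ := by gcongr
    linarith

/-- Abel summation with the weight taken at the last index. -/
lemma sum_mul_Icc_by_parts (γ d : ℕ → ℝ) (n : ℕ) :
    ∑ k ∈ Finset.Icc 1 n, γ k * d k = γ n * ∑ k ∈ Finset.Icc 1 n, d k
      + ∑ k ∈ Finset.range n, (γ k - γ (k + 1)) * ∑ i ∈ Finset.Icc 1 k, d i := by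
  induction n with
  | zero => simp
  | succ n ih =>
    rw [Finset.sum_Icc_succ_top (by omega), ih, Finset.sum_Icc_succ_top (by omega),
      Finset.sum_range_succ]
    ring

/-- If the partial sums of `d` are `O(n / log(n+2)^{1+ε})` and `γ` is nonincreasing with
`Γ_n = O(log n)`, then `∑ γ_k d_k` converges. -/
lemma exists_tendsto_sum_mul {γ d : ℕ → ℝ} (hγ : ∀ n, 1 ≤ n → γ n ∈ Set.Ioo (0 : ℝ) 1)
    (hS : AntitoneOn γ (Set.Ici 1)) {ε C K : ℝ} (hε : 0 < ε) (hC : 0 < C) (hK : 0 ≤ K)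
    (hlog : ∀ n : ℕ, 1 + stepSum γ n ≤ C * Real.log (n + 2))
    (hd : ∀ n : ℕ, |∑ k ∈ Finset.Icc 1 n, d k| ≤ K * (n / Real.log (n + 2) ^ (1 + ε))) :
    ∃ T, Tendsto (fun n => ∑ k ∈ Finset.Icc 1 n, γ k * d k) atTop (𝓝 T) := by
  set φ : ℕ → ℝ := fun n => n / Real.log (n + 2) ^ (1 + ε) with hφ
  have hlp : ∀ n : ℕ, 0 < Real.log (n + 2) := fun n => by
    apply Real.log_pos; linarith [n.cast_nonneg (α := ℝ)]
  have hLp : ∀ n : ℕ, 0 < Real.log (n + 2) ^ (1 + ε) := fun n => Real.rpow_pos_of_pos (hlp n) _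
  have hφ0 : ∀ n, 0 ≤ φ n := fun n => div_nonneg n.cast_nonneg (hLp n).le
  have hφinc : ∀ n : ℕ, φ (n + 1) - φ n ≤ 1 / Real.log ((n + 1 : ℕ) + 2) ^ (1 + ε) := by
    intro n
    have h1 : (n : ℝ) / Real.log ((n + 1 : ℕ) + 2) ^ (1 + ε) ≤ φ n := by
      have hmon : Real.log (n + 2) ≤ Real.log ((n + 1 : ℕ) + 2) :=
        Real.log_le_log (by positivity) (by push_cast; linarith)
      have := hlp n
      exact div_le_div_of_nonneg_left n.cast_nonneg (hLp n)
        (Real.rpow_le_rpow this.le hmon (by linarith))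
    have h2 : φ (n + 1) = n / Real.log ((n + 1 : ℕ) + 2) ^ (1 + ε)
        + 1 / Real.log ((n + 1 : ℕ) + 2) ^ (1 + ε) := by
      simp only [hφ]; push_cast; ring
    linarith
  -- As `1 + Γ_n ≤ C log(n+2)`, the logarithm may be traded for `1 + Γ_n`, whose series is summable.
  have hterm : ∀ n : ℕ, 1 ≤ n → γ n * (1 / Real.log (n + 2) ^ (1 + ε))
      ≤ C ^ (1 + ε) * (γ n / (1 + stepSum γ n) ^ (1 + ε)) := by
    intro n hn
    have hG : 0 < 1 + stepSum γ n := by linarith [stepSum_nonneg hγ n]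
    have h1 : (1 + stepSum γ n) ^ (1 + ε) ≤ C ^ (1 + ε) * Real.log (n + 2) ^ (1 + ε) := by
      rw [← Real.mul_rpow hC.le (hlp n).le]
      exact Real.rpow_le_rpow hG.le (hlog n) (by linarith)
    have h2 : 0 < (1 + stepSum γ n) ^ (1 + ε) := Real.rpow_pos_of_pos hG _
    have := hLp n
    have hp := (hγ n hn).1
    rw [mul_one_div, mul_div_assoc', div_le_div_iff₀ this h2]
    nlinarith
  have hsum : ∀ n, ∑ k ∈ Finset.Icc 1 n, (γ k - γ (k + 1)) * φ k ≤ C ^ (1 + ε) * (1 / ε) := by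
    intro n
    -- Summation by parts in reverse: the left side equals `∑ γ_k (φ_k - φ_{k-1})`, and the
    -- increments of `φ` are at most `1/log^{1+ε}`.
    have h0 : ∀ n : ℕ, ∑ k ∈ Finset.Icc 1 n, (γ k - γ (k + 1)) * φ k + γ (n + 1) * φ n
        ≤ C ^ (1 + ε) * ∑ k ∈ Finset.Icc 1 n, γ k / (1 + stepSum γ k) ^ (1 + ε) := by
      intro n
      induction n with
      | zero => simp [hφ]
      | succ n ih =>
        rw [Finset.sum_Icc_succ_top (by omega), Finset.sum_Icc_succ_top (by omega)]
        have h1 := hterm (n + 1) (by omega)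
        have h2 := mul_le_mul_of_nonneg_left (hφinc n) (hγ (n + 1) (by omega)).1.le
        linarith
    have h1 := h0 n
    have h2 := mul_nonneg (hγ (n + 1) (by omega)).1.le (hφ0 n)
    have h3 := mul_le_mul_of_nonneg_left (sum_step_div_rpow_le hγ hε n)
      (Real.rpow_nonneg hC.le (1 + ε))
    linarith
  set S : ℕ → ℝ := fun n => ∑ k ∈ Finset.Icc 1 n, d k with hSdef
  have hdiff : ∀ n, 1 ≤ n → 0 ≤ γ n - γ (n + 1) := fun n hn =>
    sub_nonneg.2 (hS (Set.mem_Ici.2 hn) (Set.mem_Ici.2 (by omega)) (by omega))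
  -- The index is shifted because `γ 0` is arbitrary, so that `γ 0 - γ 1` has no known sign.
  have hs : Summable fun k => (γ (k + 1) - γ (k + 1 + 1)) * S (k + 1) := by
    have hs' : Summable fun k => K * ((γ (k + 1) - γ (k + 1 + 1)) * φ (k + 1)) := by
      refine Summable.mul_left _ (summable_of_sum_range_le (c := C ^ (1 + ε) * (1 / ε))
        (fun k => mul_nonneg (hdiff _ (by omega)) (hφ0 _)) fun n => ?_)
      refine le_trans (le_of_eq ?_) (hsum n)
      rw [Finset.range_eq_Ico, Finset.sum_Ico_add' (fun k => (γ k - γ (k + 1)) * φ k) 0 n 1]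
      rfl
    refine Summable.of_norm_bounded hs' fun k => ?_
    rw [Real.norm_eq_abs, abs_mul, abs_of_nonneg (hdiff _ (by omega))]
    have := mul_le_mul_of_nonneg_left (hd (k + 1)) (hdiff (k + 1) (by omega))
    simp only [hφ, hSdef]
    linarith
  have hs0 : Summable fun k => (γ k - γ (k + 1)) * S k :=
    (summable_nat_add_iff (f := fun k => (γ k - γ (k + 1)) * S k) 1).1 hs
  -- The boundary term is `O(log^{-ε})`, since monotonicity gives `n γ_n ≤ Γ_n = O(log n)`.
  have hbd : Tendsto (fun n => γ n * S n) atTop (𝓝 0) := by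
    have hlt : Tendsto (fun n : ℕ => K * C * Real.log (n + 2) ^ (-ε)) atTop (𝓝 0) := by
      rw [← mul_zero (K * C)]
      refine Tendsto.const_mul _ ((tendsto_rpow_neg_atTop hε).comp (Real.tendsto_log_atTop.comp ?_))
      exact tendsto_atTop_add_const_right _ _ tendsto_natCast_atTop_atTop
    refine squeeze_zero_norm' ?_ hlt
    filter_upwards [eventually_ge_atTop 1] with n hn
    have hp := (hγ n hn).1
    rw [Real.norm_eq_abs, abs_mul, abs_of_pos hp]
    have h1 : γ n * |S n| ≤ γ n * (K * (n / Real.log (n + 2) ^ (1 + ε))) := by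
      gcongr; exact hd n
    refine h1.trans ?_
    have h2 : (n : ℝ) * γ n ≤ C * Real.log (n + 2) := by
      linarith [nat_mul_le_stepSum hS n, hlog n]
    have hl := hlp n
    have h3 : Real.log (n + 2) ^ (-ε)
        = Real.log (n + 2) / Real.log (n + 2) ^ (1 + ε) := by
      rw [Real.rpow_add hl, Real.rpow_one, Real.rpow_neg hl.le]
      have := Real.rpow_pos_of_pos hl ε
      field_simp
    rw [h3]
    have := hLp n
    calc γ n * (K * (n / Real.log (n + 2) ^ (1 + ε)))
        = K * ((n * γ n) / Real.log (n + 2) ^ (1 + ε)) := by ring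
      _ ≤ K * ((C * Real.log (n + 2)) / Real.log (n + 2) ^ (1 + ε)) := by gcongr
      _ = _ := by ring
  refine ⟨0 + ∑' k, (γ k - γ (k + 1)) * S k, ?_⟩
  simp_rw [sum_mul_Icc_by_parts]
  exact hbd.add hs0.hasSum.tendsto_sum_nat

/-! ### Divergence of `∑ e^{-bΓ_k}`, also along the successes of one arm -/

/-- Abel summation: nonincreasing nonnegative weights preserve a lower bound on partial sums, up to
the first weight. -/
lemma sum_mul_ge_of_antitone {w e : ℕ → ℝ} (hw : Antitone w) (hw0 : ∀ n, 0 ≤ w n) {C : ℝ}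
    (he : ∀ n, -C ≤ ∑ k ∈ Finset.range n, e k) (n : ℕ) :
    -C * w 0 ≤ ∑ k ∈ Finset.range n, w k * e k := by
  have h : ∀ n, w n * (∑ k ∈ Finset.range n, e k) - C * (w 0 - w n)
      ≤ ∑ k ∈ Finset.range n, w k * e k := by
    intro n
    induction n with
    | zero => simp
    | succ n ih =>
      have h1 := mul_nonneg (sub_nonneg.2 (hw (Nat.le_succ n)))
        (by linarith [he (n + 1)] : 0 ≤ ∑ k ∈ Finset.range (n + 1), e k + C)
      rw [Finset.sum_range_succ] at h1 ⊢
      rw [Finset.sum_range_succ]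
      simp only [Nat.succ_eq_add_one] at h1
      linarith
  have := h n
  nlinarith [mul_le_mul_of_nonneg_left (he n) (hw0 n)]

/-- By (S2), `e^{-bΓ_k}` dominates a multiple of `γ_{k+1}/(1+Γ_k)`, hence of the increment of
`log(1+Γ)`, which diverges. -/
lemma tendsto_sum_exp_neg_stepSum {γ : ℕ → ℝ} {b : ℝ} (hb : 0 < b)
    (hγ : ∀ n, 1 ≤ n → γ n ∈ Set.Ioo (0 : ℝ) 1) (hS1 : StepCond1 γ) (hS2 : StepCond2 γ b) :
    Tendsto (fun n => ∑ k ∈ Finset.range n, Real.exp (-b * stepSum γ k)) atTop atTop := by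
  obtain ⟨C, hC, h⟩ := hS2.exists_bound hγ
  have key : ∀ n, 1 / C * Real.log (1 + stepSum γ n)
      ≤ ∑ k ∈ Finset.range n, Real.exp (-b * stepSum γ k) := by
    intro n
    induction n with
    | zero => simp [stepSum_zero]
    | succ n ih =>
      rw [Finset.sum_range_succ]
      have hG := stepSum_nonneg hγ n
      have hg := hγ (n + 1) (by omega)
      have h1 := h (n + 1) (by omega)
      have hE : Real.exp (-b * stepSum γ (n + 1)) ≤ Real.exp (-b * stepSum γ n) := by
        rw [Real.exp_le_exp, stepSum_succ]; nlinarith [hg.1]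
      have h2 : γ (n + 1) ≤ C * ((1 + stepSum γ n) * Real.exp (-b * stepSum γ n)) := by
        refine h1.trans ?_
        have : stepSum γ (n + 1) ≤ 1 + stepSum γ n := by rw [stepSum_succ]; linarith [hg.2]
        gcongr
      have h3 : Real.log (1 + stepSum γ (n + 1)) - Real.log (1 + stepSum γ n)
          ≤ γ (n + 1) / (1 + stepSum γ n) := by
        have hpos : 0 < 1 + stepSum γ (n + 1) := by linarith [stepSum_nonneg hγ (n + 1)]
        rw [← Real.log_div hpos.ne' (by positivity)]
        refine (Real.log_le_sub_one_of_pos (by positivity)).trans (le_of_eq ?_)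
        rw [stepSum_succ]; field_simp; ring
      have h4 : γ (n + 1) / (1 + stepSum γ n) ≤ C * Real.exp (-b * stepSum γ n) := by
        rw [div_le_iff₀ (by positivity)]; linarith
      have h5 : 1 / C * (Real.log (1 + stepSum γ (n + 1)) - Real.log (1 + stepSum γ n))
          ≤ Real.exp (-b * stepSum γ n) := by
        rw [one_div, inv_mul_le_iff₀ hC]; linarith
      linarith
  refine tendsto_atTop_mono key (Tendsto.const_mul_atTop (by positivity) ?_)
  exact Real.tendsto_log_atTop.comp (tendsto_atTop_add_const_left _ _ hS1.2)

/-- The deviations `∑_{i ≤ n} (η_{ℓ,i} - θ_ℓ)` of one arm under the ergodic condition. -/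
lemma ErgodicCond2.exists_bound {η : Arm → ℕ → ℝ} {θ : Arm → ℝ} (h : ErgodicCond2 η θ) :
    ∃ ε : ℝ, 0 < ε ∧ ∃ K : ℝ, 0 ≤ K ∧ ∀ ℓ, ∀ n : ℕ, |∑ k ∈ Finset.Icc 1 n, (η ℓ k - θ ℓ)|
      ≤ K * (n / Real.log (n + 2) ^ (1 + ε)) := by
  obtain ⟨ε, hε, h⟩ := h
  obtain ⟨K, hK⟩ := (Metric.isBounded_range_of_tendsto _ h).exists_norm_le
  refine ⟨ε, hε, K, (norm_nonneg _).trans (hK _ ⟨0, rfl⟩), fun ℓ n => ?_⟩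
  rcases Nat.eq_zero_or_pos n with rfl | hn
  · simp
  have h1 : |∑ k ∈ Finset.Icc 1 n, (η ℓ k - θ ℓ)| ≤ payoffDeviation η θ n := by
    cases ℓ
    · exact le_max_left _ _
    · exact le_max_right _ _
  refine h1.trans ?_
  have h2 := (le_abs_self _).trans (hK _ ⟨n, rfl⟩)
  rwa [div_le_iff₀] at h2
  have : 0 < Real.log ((n : ℝ) + 2) := Real.log_pos (by linarith [n.cast_nonneg (α := ℝ)])
  exact div_pos (by exact_mod_cast hn) (Real.rpow_pos_of_pos this _)

/-- The deviations are `o(n)`, so the gain `nδ` makes the sum eventually nonnegative; finitely many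
`n` remain. -/
lemma ErgodicCond2.exists_linear_lower_bound {η : Arm → ℕ → ℝ} {θ : Arm → ℝ} (h : ErgodicCond2 η θ)
    (ℓ : Arm) {δ : ℝ} (hδ : 0 < δ) :
    ∃ C, ∀ n : ℕ, -C ≤ ∑ k ∈ Finset.range n, (η ℓ (k + 1) - (θ ℓ - δ)) := by
  obtain ⟨ε, hε, K, hK, hb⟩ := h.exists_bound
  have hlim : Tendsto (fun n : ℕ => K * Real.log (n + 2) ^ (-(1 + ε))) atTop (𝓝 0) := by
    rw [← mul_zero K]
    refine Tendsto.const_mul _ ((tendsto_rpow_neg_atTop (by linarith)).comp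
      (Real.tendsto_log_atTop.comp ?_))
    exact tendsto_atTop_add_const_right _ _ tendsto_natCast_atTop_atTop
  have heq : ∀ n, ∑ k ∈ Finset.range n, (η ℓ (k + 1) - (θ ℓ - δ))
      = ∑ k ∈ Finset.Icc 1 n, (η ℓ k - θ ℓ) + n * δ := by
    intro n
    induction n with
    | zero => simp
    | succ n ih =>
      rw [Finset.sum_range_succ, ih, Finset.sum_Icc_succ_top (by omega)]; push_cast; ring
  have hev : ∀ᶠ n : ℕ in atTop, 0 ≤ ∑ k ∈ Finset.range n, (η ℓ (k + 1) - (θ ℓ - δ)) := by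
    filter_upwards [hlim.eventually (gt_mem_nhds hδ)] with n hn
    have h1 := (abs_le.1 (hb ℓ n)).1
    have hl : 0 < Real.log ((n : ℝ) + 2) := Real.log_pos (by linarith [n.cast_nonneg (α := ℝ)])
    rw [Real.rpow_neg hl.le] at hn
    have h2 := mul_le_mul_of_nonneg_right hn.le (n.cast_nonneg (α := ℝ))
    rw [heq]
    have h3 : K * (n / Real.log (n + 2) ^ (1 + ε)) = K * (Real.log (n + 2) ^ (1 + ε))⁻¹ * n := by
      ring
    linarith
  obtain ⟨C, hC⟩ : BddBelow (Set.range fun n : ℕ =>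
      ∑ k ∈ Finset.range n, (η ℓ (k + 1) - (θ ℓ - δ))) :=
    Filter.IsBoundedUnder.bddBelow_range ⟨0, by simpa using hev⟩
  exact ⟨-C, fun n => by simpa using hC ⟨n, rfl⟩⟩

/-- The payoffs average to more than `θ ℓ / 2`, and the weights are nonincreasing, so replacing `η`
by `θ ℓ / 2` costs only a bounded amount. -/
lemma tendsto_sum_exp_neg_stepSum_mul {γ : ℕ → ℝ} {η : Arm → ℕ → ℝ} {θ : Arm → ℝ} {b : ℝ}
    (hb : 0 < b) (hγ : ∀ n, 1 ≤ n → γ n ∈ Set.Ioo (0 : ℝ) 1) (hS1 : StepCond1 γ)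
    (hS2 : StepCond2 γ b) (hE2 : ErgodicCond2 η θ) {ℓ : Arm} (hθ : 0 < θ ℓ) :
    Tendsto (fun n => ∑ k ∈ Finset.range n, Real.exp (-b * stepSum γ k) * η ℓ (k + 1))
      atTop atTop := by
  obtain ⟨C, hC⟩ := hE2.exists_linear_lower_bound ℓ (half_pos hθ)
  have hw : Antitone fun k => Real.exp (-b * stepSum γ k) := fun m n hmn => by
    simp only [Real.exp_le_exp]; nlinarith [monotone_stepSum hγ hmn]
  refine tendsto_atTop_mono (fun n => ?_) (tendsto_atTop_add_const_left _
    (-C * Real.exp (-b * stepSum γ 0))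
    ((tendsto_sum_exp_neg_stepSum hb hγ hS1 hS2).const_mul_atTop (half_pos hθ)))
  have h1 := sum_mul_ge_of_antitone hw (fun k => (Real.exp_pos _).le) hC n
  have h2 : ∑ k ∈ Finset.range n, Real.exp (-b * stepSum γ k) * (η ℓ (k + 1) - (θ ℓ - θ ℓ / 2))
      = ∑ k ∈ Finset.range n, Real.exp (-b * stepSum γ k) * η ℓ (k + 1)
        - θ ℓ / 2 * ∑ k ∈ Finset.range n, Real.exp (-b * stepSum γ k) := by
    rw [Finset.mul_sum, ← Finset.sum_sub_distrib]
    exact Finset.sum_congr rfl fun k _ => by ring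
  linarith

/-! ### The recursion and its pathwise lower bound -/

section Dynamics

variable {γ : ℕ → ℝ} {η : Arm → ℕ → ℝ} {x : ℝ}

lemma armPlayed_of_le {u X : ℝ} (h : u ≤ X) : armPlayed u X = Arm.A := if_pos h

lemma armPlayed_of_lt {u X : ℝ} (h : X < u) : armPlayed u X = Arm.B := if_neg h.not_ge

/-- The updating rule written with the payoffs as real factors. -/
lemma narendraStep_armPlayed {g a b : ℝ} (ha : a = 0 ∨ a = 1) (hb : b = 0 ∨ b = 1) (u X : ℝ) :
    narendraStep g a b (armPlayed u X) X
      = if u ≤ X then X + g * a * (1 - X) else X - g * b * X := by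
  by_cases h : u ≤ X
  · rcases ha with rfl | rfl <;> simp [narendraStep, armPlayed_of_le h, h]
  · rcases hb with rfl | rfl <;> simp [narendraStep, armPlayed_of_lt (not_le.1 h), h]
    ring

lemma narendra_succ (hη : ∀ ℓ n, 1 ≤ n → η ℓ n = 0 ∨ η ℓ n = 1) (u : ℕ → ℝ) (n : ℕ) :
    narendra γ η x u (n + 1) = if u (n + 1) ≤ narendra γ η x u n
      then narendra γ η x u n + γ (n + 1) * η Arm.A (n + 1) * (1 - narendra γ η x u n)
      else narendra γ η x u n - γ (n + 1) * η Arm.B (n + 1) * narendra γ η x u n := by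
  rw [narendra, narendraStep_armPlayed (hη _ _ (by omega)) (hη _ _ (by omega))]

lemma narendra_mem_Ioo (hγ : ∀ n, 1 ≤ n → γ n ∈ Set.Ioo (0 : ℝ) 1)
    (hη : ∀ ℓ n, 1 ≤ n → η ℓ n = 0 ∨ η ℓ n = 1) (hx : x ∈ Set.Ioo (0 : ℝ) 1) (u : ℕ → ℝ) (n : ℕ) :
    narendra γ η x u n ∈ Set.Ioo (0 : ℝ) 1 := by
  induction n with
  | zero => exact hx
  | succ n ih =>
    obtain ⟨h0, h1⟩ := ih
    obtain ⟨g0, g1⟩ := hγ (n + 1) (by omega)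
    rw [narendra_succ hη]
    split_ifs
    · rcases hη Arm.A (n + 1) (by omega) with h | h <;> rw [h] <;> constructor <;> nlinarith
    · rcases hη Arm.B (n + 1) (by omega) with h | h <;> rw [h] <;> constructor <;> nlinarith

/-- Whichever arm is played, a step multiplies the state by at least `1 - γ η_B`. The logarithm of
the product is `-∑ γ η_B` up to a multiple of `∑ γ²`, and `∑ γ η_B` exceeds `θ_B Γ_n` by at most
`T`. The constant does not depend on the input `u`. -/
lemma exists_exp_le_narendra {θ : Arm → ℝ} (hγ : ∀ n, 1 ≤ n → γ n ∈ Set.Ioo (0 : ℝ) 1)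
    (hη : ∀ ℓ n, 1 ≤ n → η ℓ n = 0 ∨ η ℓ n = 1) (hx : x ∈ Set.Ioo (0 : ℝ) 1)
    (hS : AntitoneOn γ (Set.Ici 1)) {Q T : ℝ} (hQ : ∀ n, ∑ k ∈ Finset.Icc 1 n, γ k ^ 2 ≤ Q)
    (hT : ∀ n, ∑ k ∈ Finset.Icc 1 n, γ k * (η Arm.B k - θ Arm.B) ≤ T) :
    ∃ c ∈ Set.Ioo (0 : ℝ) 1, ∀ (u : ℕ → ℝ) (n : ℕ),
      c * Real.exp (-θ Arm.B * stepSum γ n) ≤ narendra γ η x u n := by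
  have hγ1 : 0 < 1 - γ 1 := sub_pos.2 (hγ 1 le_rfl).2
  have key : ∀ (u : ℕ → ℝ) (n : ℕ), x * Real.exp (-(θ Arm.B * stepSum γ n
      + ∑ k ∈ Finset.Icc 1 n, γ k * (η Arm.B k - θ Arm.B)
      + 1 / (1 - γ 1) * ∑ k ∈ Finset.Icc 1 n, γ k ^ 2)) ≤ narendra γ η x u n := by
    intro u n
    induction n with
    | zero => simp [stepSum_zero, narendra]
    | succ n ih =>
      obtain ⟨g0, g1⟩ := hγ (n + 1) (by omega)
      have hg : γ (n + 1) ≤ γ 1 := hS (Set.mem_Ici.2 le_rfl) (Set.mem_Ici.2 (by omega)) (by omega)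
      obtain ⟨h0, h1⟩ := narendra_mem_Ioo hγ hη hx u n
      have hstep : narendra γ η x u n * (1 - γ (n + 1) * η Arm.B (n + 1))
          ≤ narendra γ η x u (n + 1) := by
        rw [narendra_succ hη]
        split_ifs
        · rcases hη Arm.A (n + 1) (by omega) with h | h <;>
          rcases hη Arm.B (n + 1) (by omega) with h' | h' <;> rw [h, h'] <;> nlinarith
        · linarith
      have hexp : Real.exp (-(γ (n + 1) * η Arm.B (n + 1) + 1 / (1 - γ 1) * γ (n + 1) ^ 2))
          ≤ 1 - γ (n + 1) * η Arm.B (n + 1) := by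
        rcases hη Arm.B (n + 1) (by omega) with h | h <;> rw [h]
        · have : 0 ≤ 1 / (1 - γ 1) * γ (n + 1) ^ 2 := by positivity
          rw [mul_zero, sub_zero, Real.exp_le_one_iff]; linarith
        · have hlog := Real.one_sub_inv_le_log_of_pos (sub_pos.2 g1)
          rw [mul_one, ← Real.le_log_iff_exp_le (sub_pos.2 g1)]
          refine le_trans ?_ hlog
          have h2 : 1 - (1 - γ (n + 1))⁻¹
              = -(γ (n + 1) + 1 / (1 - γ (n + 1)) * γ (n + 1) ^ 2) := by
            have := (sub_pos.2 g1).ne'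
            field_simp; ring
          rw [h2, neg_le_neg_iff]
          gcongr
      refine le_trans ?_ ((mul_le_mul ih hexp (Real.exp_pos _).le h0.le).trans hstep)
      rw [mul_assoc, ← Real.exp_add, Finset.sum_Icc_succ_top (by omega),
        Finset.sum_Icc_succ_top (by omega), stepSum_succ]
      apply le_of_eq
      ring_nf
  -- `T` and `Q` carry no sign assumption; the absolute values ensure `c < 1`.
  have hc : 0 < x * Real.exp (-(|T| + 1 / (1 - γ 1) * |Q|)) := mul_pos hx.1 (Real.exp_pos _)
  refine ⟨x * Real.exp (-(|T| + 1 / (1 - γ 1) * |Q|)), ⟨hc, ?_⟩, fun u n => ?_⟩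
  · have : Real.exp (-(|T| + 1 / (1 - γ 1) * |Q|)) ≤ 1 := by
      rw [Real.exp_le_one_iff, neg_nonpos]; positivity
    nlinarith [hx.1, hx.2]
  · refine le_trans ?_ (key u n)
    rw [mul_assoc, ← Real.exp_add]
    have h1 := (hT n).trans (le_abs_self T)
    have h2 := mul_le_mul_of_nonneg_left ((hQ n).trans (le_abs_self Q))
      (by positivity : 0 ≤ 1 / (1 - γ 1))
    have := hx.1
    gcongr
    linarith

end Dynamics

/-! ### One-step drift of the corrected state and of its exponential -/

/-- The state `X` corrected by a multiple of `X (1 - X)`. -/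
noncomputable def corrected (r X : ℝ) : ℝ := X + r * (X * (1 - X))

lemma continuous_corrected (r : ℝ) : Continuous (corrected r) := by
  unfold corrected; fun_prop

lemma abs_corrected_le {r X : ℝ} (hr : |r| ≤ 1) (hX : X ∈ Set.Icc (0 : ℝ) 1) :
    |corrected r X| ≤ 2 := by
  obtain ⟨h0, h1⟩ := hX
  obtain ⟨r0, r1⟩ := abs_le.1 hr
  have h : 0 ≤ X * (1 - X) := mul_nonneg h0 (by linarith)
  rw [abs_le]
  constructor <;> unfold corrected <;> nlinarith

lemma le_corrected {r X δ : ℝ} (hr : |r| ≤ δ) (hX : X ∈ Set.Icc (0 : ℝ) 1) :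
    (1 - δ) * X ≤ corrected r X := by
  obtain ⟨h0, h1⟩ := hX
  obtain ⟨r0, r1⟩ := abs_le.1 hr
  have h : 0 ≤ X * (1 - X) := mul_nonneg h0 (by linarith)
  unfold corrected
  nlinarith [mul_nonneg ((abs_nonneg r).trans hr) (mul_nonneg h0 h0),
    mul_nonneg (by linarith : 0 ≤ r + δ) h]

section OneStep

variable {g a b d r X : ℝ} (hg : g ∈ Set.Ioo (0 : ℝ) 1) (ha : a = 0 ∨ a = 1) (hb : b = 0 ∨ b = 1)
  (hd : d ∈ Set.Ioo (0 : ℝ) 1) (hr : |r| ≤ d / 4) (hX : X ∈ Set.Ioo (0 : ℝ) 1)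
include hg ha hb hd hr hX

omit hd in
-- The change of corrector replaces `a - b` by `d`, so the exact drift is `g X(1-X)(d + r q)`, where
-- `q` comes from the variation of `X(1-X)`. As `|q| ≤ 2` and `|r| ≤ d/4`, at least `d/2` survives.
lemma corrected_drift (hd : 0 < d) : corrected (r + g * (a - b - d)) X + d / 2 * (g * (X * (1 - X))) ≤
    X * corrected r (X + g * a * (1 - X)) + (1 - X) * corrected r (X - g * b * X) := by
  obtain ⟨g0, g1⟩ := hg
  obtain ⟨h0, h1⟩ := hX
  obtain ⟨r0, r1⟩ := abs_le.1 hr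
  have a0 : 0 ≤ a ∧ a ≤ 1 := by rcases ha with rfl | rfl <;> norm_num
  have b0 : 0 ≤ b ∧ b ≤ 1 := by rcases hb with rfl | rfl <;> norm_num
  set q := a * (1 - (X + g * a * (1 - X)) - X) - b * (1 - (X - g * b * X) - X) with hq
  have hu : |1 - (X + g * a * (1 - X)) - X| ≤ 1 := by
    have : g * a ≤ 1 := by nlinarith
    have : 0 ≤ g * a := mul_nonneg g0.le a0.1
    rw [abs_le]; constructor <;> nlinarith
  have hv : |1 - (X - g * b * X) - X| ≤ 1 := by
    have : g * b ≤ 1 := by nlinarith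
    have : 0 ≤ g * b := mul_nonneg g0.le b0.1
    rw [abs_le]; constructor <;> nlinarith
  have hq2 : |q| ≤ 2 := by
    refine (abs_sub _ _).trans ?_
    rw [abs_mul, abs_mul, abs_of_nonneg a0.1, abs_of_nonneg b0.1]
    nlinarith [abs_nonneg (1 - (X + g * a * (1 - X)) - X), abs_nonneg (1 - (X - g * b * X) - X)]
  have hrq : -(d / 2) ≤ r * q := by
    have : |r * q| ≤ d / 4 * 2 := by
      rw [abs_mul]; exact mul_le_mul hr hq2 (abs_nonneg _) (by linarith)
    linarith [(abs_le.1 this).1]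
  have hh : 0 ≤ g * (X * (1 - X)) := by
    have := sub_pos.2 h1
    positivity
  have hkey : X * corrected r (X + g * a * (1 - X)) + (1 - X) * corrected r (X - g * b * X)
      - corrected (r + g * (a - b - d)) X = g * (X * (1 - X)) * (d + r * q) := by
    unfold corrected; rw [hq]; ring
  nlinarith [mul_nonneg hh (by linarith : 0 ≤ r * q + d / 2)]

/-- Up-moves are of size `1-X` and occur with probability `X`, and symmetrically for down-moves. The
second moment thus carries the same factor `X(1-X)` as the drift. -/
lemma abs_corrected_up_sub_le :
    |corrected r (X + g * a * (1 - X)) - corrected (r + g * (a - b - d)) X| ≤ 4 * (g * (1 - X)) := by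
  obtain ⟨g0, g1⟩ := hg
  obtain ⟨h0, h1⟩ := hX
  obtain ⟨d0, d1⟩ := hd
  have hr1 : |r| ≤ 1 := by linarith
  have ha1 : |a| ≤ 1 := by rcases ha with rfl | rfl <;> norm_num
  have hab : |a - b - d| ≤ 2 := by
    rw [abs_le]; rcases ha with rfl | rfl <;> rcases hb with rfl | rfl <;> constructor <;> linarith
  have hu : |1 - (X + g * a * (1 - X)) - X| ≤ 1 := by
    rw [abs_le]; rcases ha with rfl | rfl <;> constructor <;> nlinarith
  have h1X := sub_pos.2 h1
  have e : corrected r (X + g * a * (1 - X)) - corrected (r + g * (a - b - d)) X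
      = g * (1 - X) * (a + a * r * (1 - (X + g * a * (1 - X)) - X) - X * (a - b - d)) := by
    unfold corrected; ring
  rw [e, abs_mul, abs_of_pos (mul_pos g0 h1X), mul_comm 4]
  gcongr
  have h2 : |a * r * (1 - (X + g * a * (1 - X)) - X)| ≤ 1 * 1 * 1 := by
    rw [abs_mul, abs_mul]; gcongr
  have h3 : |X * (a - b - d)| ≤ 1 * 2 := by
    rw [abs_mul, abs_of_pos h0]; gcongr
  refine (abs_sub _ _).trans ?_
  linarith [abs_add_le a (a * r * (1 - (X + g * a * (1 - X)) - X))]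

lemma abs_corrected_down_sub_le :
    |corrected r (X - g * b * X) - corrected (r + g * (a - b - d)) X| ≤ 4 * (g * X) := by
  obtain ⟨g0, g1⟩ := hg
  obtain ⟨h0, h1⟩ := hX
  obtain ⟨d0, d1⟩ := hd
  have hr1 : |r| ≤ 1 := by linarith
  have hb1 : |b| ≤ 1 := by rcases hb with rfl | rfl <;> norm_num
  have hab : |a - b - d| ≤ 2 := by
    rw [abs_le]; rcases ha with rfl | rfl <;> rcases hb with rfl | rfl <;> constructor <;> linarith
  have hu : |1 - (X - g * b * X) - X| ≤ 1 := by
    rw [abs_le]; rcases hb with rfl | rfl <;> constructor <;> nlinarith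
  have h1X := sub_pos.2 h1
  have e : corrected r (X - g * b * X) - corrected (r + g * (a - b - d)) X
      = -(g * X * (b + b * r * (1 - (X - g * b * X) - X) + (1 - X) * (a - b - d))) := by
    unfold corrected; ring
  rw [e, abs_neg, abs_mul, abs_of_pos (mul_pos g0 h0), mul_comm 4]
  gcongr
  have h2 : |b * r * (1 - (X - g * b * X) - X)| ≤ 1 * 1 * 1 := by
    rw [abs_mul, abs_mul]; gcongr
  have h3 : |(1 - X) * (a - b - d)| ≤ 1 * 2 := by
    rw [abs_mul, abs_of_pos h1X]; gcongr; linarith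
  refine (abs_add_le _ _).trans ?_
  linarith [abs_add_le b (b * r * (1 - (X - g * b * X) - X))]

/-- The exponential of the corrected state does not increase in mean when `l * g` is small. -/
lemma exp_corrected_drift {l : ℝ} (hl : 0 ≤ l) (hlg : l * g ≤ d / 64) :
    X * Real.exp (-l * corrected r (X + g * a * (1 - X)))
      + (1 - X) * Real.exp (-l * corrected r (X - g * b * X))
      ≤ Real.exp (-l * corrected (r + g * (a - b - d)) X) := by
  have hu := abs_corrected_up_sub_le hg ha hb hd hr hX
  have hv := abs_corrected_down_sub_le hg ha hb hd hr hX
  have hdr := corrected_drift hg ha hb hr hX hd.1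
  obtain ⟨g0, g1⟩ := hg
  obtain ⟨h0, h1⟩ := hX
  obtain ⟨d0, d1⟩ := hd
  set F := corrected (r + g * (a - b - d)) X
  set U := corrected r (X + g * a * (1 - X))
  set V := corrected r (X - g * b * X)
  have h1X := sub_pos.2 h1
  have hquad : ∀ t : ℝ, |t| ≤ 1 → Real.exp (-t) ≤ 1 - t + t ^ 2 := by
    intro t ht
    have := (abs_le.1 (Real.abs_exp_sub_one_sub_id_le (x := -t) (by rwa [abs_neg]))).2
    nlinarith
  have hlg0 : 0 ≤ l * g := mul_nonneg hl g0.le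
  have bU : |l * (U - F)| ≤ 4 * (l * g * (1 - X)) := by
    rw [abs_mul, abs_of_nonneg hl]; nlinarith
  have bV : |l * (V - F)| ≤ 4 * (l * g * X) := by
    rw [abs_mul, abs_of_nonneg hl]; nlinarith
  have eU := hquad (l * (U - F)) (bU.trans (by nlinarith))
  have eV := hquad (l * (V - F)) (bV.trans (by nlinarith))
  have sU : (l * (U - F)) ^ 2 ≤ 16 * ((l * g) ^ 2 * (1 - X)) := by
    have h : (l * (U - F)) ^ 2 ≤ (4 * (l * g * (1 - X))) ^ 2 := sq_le_sq' (abs_le.1 bU).1 (abs_le.1 bU).2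
    refine h.trans ?_
    have : (l * g) ^ 2 * (1 - X) * (1 - X) ≤ (l * g) ^ 2 * (1 - X) * 1 := by gcongr; linarith
    nlinarith
  have sV : (l * (V - F)) ^ 2 ≤ 16 * ((l * g) ^ 2 * X) := by
    have h : (l * (V - F)) ^ 2 ≤ (4 * (l * g * X)) ^ 2 := sq_le_sq' (abs_le.1 bV).1 (abs_le.1 bV).2
    refine h.trans ?_
    have : (l * g) ^ 2 * X * X ≤ (l * g) ^ 2 * X * 1 := by gcongr
    nlinarith
  -- The second-order terms add up to `32 (lg)² X(1-X)` and the drift gives `(d/2) lg X(1-X)`,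
  -- whence the threshold `lg ≤ d/64`.
  have hmean : X * Real.exp (-(l * (U - F))) + (1 - X) * Real.exp (-(l * (V - F))) ≤ 1 := by
    have m1 : X * Real.exp (-(l * (U - F)))
        ≤ X * (1 - l * (U - F) + 16 * ((l * g) ^ 2 * (1 - X))) := by gcongr; linarith
    have m2 : (1 - X) * Real.exp (-(l * (V - F)))
        ≤ (1 - X) * (1 - l * (V - F) + 16 * ((l * g) ^ 2 * X)) := by gcongr; linarith
    have m3 : 0 ≤ l * (X * U + (1 - X) * V - F - d / 2 * (g * (X * (1 - X)))) :=
      mul_nonneg hl (by linarith)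
    have m4 : 0 ≤ (l * g) * (X * (1 - X)) * (d / 64 - l * g) :=
      mul_nonneg (mul_nonneg hlg0 (mul_pos h0 h1X).le) (by linarith)
    nlinarith
  have e1 : Real.exp (-l * U) = Real.exp (-l * F) * Real.exp (-(l * (U - F))) := by
    rw [← Real.exp_add]; ring_nf
  have e2 : Real.exp (-l * V) = Real.exp (-l * F) * Real.exp (-(l * (V - F))) := by
    rw [← Real.exp_add]; ring_nf
  rw [e1, e2]
  nlinarith [Real.exp_pos (-l * F)]

end OneStep

/-! ### Conditional means and Borel-Cantelli for the uniform inputs -/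

section Uniform

variable {Ω : Type*} [mΩ : MeasurableSpace Ω] {P : Measure Ω} [IsProbabilityMeasure P]

omit [IsProbabilityMeasure P] in
lemma measure_preimage_of_isUniform_Icc {J : Ω → ℝ}
    (hU : pdf.IsUniform J (Set.Icc (0 : ℝ) 1) P volume) {s : Set ℝ} (hs : MeasurableSet s) :
    P (J ⁻¹' s) = volume (Set.Icc (0 : ℝ) 1 ∩ s) := by
  rw [hU.measure_preimage (by simp) (by simp) hs]
  simp

/-- Integrating out a uniform variable that is independent of the threshold and of the integrand. -/
lemma integral_ite_le_uniform {J X D : Ω → ℝ} (hJ : Measurable J)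
    (hU : pdf.IsUniform J (Set.Icc (0 : ℝ) 1) P volume) (hX : Measurable X) (hD : Measurable D)
    (hind : IndepFun (fun ω => (X ω, D ω)) J P) (hX01 : ∀ ω, X ω ∈ Set.Icc (0 : ℝ) 1)
    (hDi : Integrable D P) :
    ∫ ω, (if J ω ≤ X ω then D ω else 0) ∂P = ∫ ω, X ω * D ω ∂P := by
  set f : (ℝ × ℝ) × ℝ → ℝ := fun p => if p.2 ≤ p.1.1 then p.1.2 else 0 with hf
  have hfm : Measurable f := by
    refine Measurable.ite (measurableSet_le measurable_snd measurable_fst.fst)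
      measurable_fst.snd measurable_const
  have hXD : Measurable fun ω => (X ω, D ω) := hX.prodMk hD
  have hpair : Measurable fun ω => ((X ω, D ω), J ω) := hXD.prodMk hJ
  have hmap := (indepFun_iff_map_prod_eq_prod_map_map hXD.aemeasurable hJ.aemeasurable).1 hind
  have := Measure.isProbabilityMeasure_map (μ := P) hJ.aemeasurable
  have := Measure.isProbabilityMeasure_map (μ := P) hXD.aemeasurable
  have hint : Integrable f (P.map fun ω => ((X ω, D ω), J ω)) := by
    rw [integrable_map_measure hfm.aestronglyMeasurable hpair.aemeasurable]
    refine hDi.mono (hfm.comp hpair).aestronglyMeasurable (ae_of_all _ fun ω => ?_)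
    simp only [hf, Function.comp]
    split_ifs <;> simp
  calc ∫ ω, (if J ω ≤ X ω then D ω else 0) ∂P
      = ∫ p, f p ∂(P.map fun ω => ((X ω, D ω), J ω)) := by
        rw [integral_map hpair.aemeasurable hfm.aestronglyMeasurable]
    _ = ∫ q, ∫ u, f (q, u) ∂(P.map J) ∂(P.map fun ω => (X ω, D ω)) := by
        rw [hmap] at hint ⊢
        rw [integral_prod _ hint]
    _ = ∫ ω, ∫ u, f ((X ω, D ω), u) ∂(P.map J) ∂P := by
        rw [integral_map hXD.aemeasurable]
        exact (StronglyMeasurable.integral_prod_right (f := fun (q : ℝ × ℝ) (u : ℝ) => f (q, u))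
          hfm.stronglyMeasurable).aestronglyMeasurable
    _ = ∫ ω, X ω * D ω ∂P := by
        refine integral_congr_ae (ae_of_all _ fun ω => ?_)
        have h1 : (fun u => f ((X ω, D ω), u)) = (Set.Iic (X ω)).indicator fun _ => D ω := by
          ext u; simp [hf, Set.indicator]
        have h2 : Set.Icc (0 : ℝ) 1 ∩ Set.Iic (X ω) = Set.Icc 0 (X ω) := by
          ext u
          have := (hX01 ω).2
          simp only [Set.mem_inter_iff, Set.mem_Icc, Set.mem_Iic]
          constructor
          · rintro ⟨⟨h, _⟩, h'⟩; exact ⟨h, h'⟩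
          · rintro ⟨h, h'⟩; exact ⟨⟨h, h'.trans this⟩, h'⟩
        have h3 : (P.map J).real (Set.Iic (X ω)) = X ω := by
          rw [Measure.real, Measure.map_apply hJ measurableSet_Iic,
            measure_preimage_of_isUniform_Icc hU measurableSet_Iic, h2, Real.volume_Icc, sub_zero,
            ENNReal.toReal_ofReal (hX01 ω).1]
        simp only [h1]
        rw [integral_indicator_const _ measurableSet_Iic, h3, smul_eq_mul]

/-- The conditional mean given `m` of a choice made with probability `X`, tested on `A`. Subtracting
`V` leaves one branch, with integrand `1_A (U - V)` independent of `J`. -/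
lemma setIntegral_ite_le_uniform {Ω : Type*} {m mΩ : MeasurableSpace Ω} {P : Measure Ω}
    [IsProbabilityMeasure P] (hm : m ≤ mΩ) {J X U V : Ω → ℝ}
    (hJ : Measurable J) (hunif : pdf.IsUniform J (Set.Icc (0 : ℝ) 1) P volume)
    (hind : Indep m (MeasurableSpace.comap J inferInstance) P)
    (hX : Measurable[m] X) (hU : Measurable[m] U) (hV : Measurable[m] V)
    (hX01 : ∀ ω, X ω ∈ Set.Icc (0 : ℝ) 1) {C : ℝ} (hUC : ∀ ω, |U ω| ≤ C) (hVC : ∀ ω, |V ω| ≤ C)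
    {A : Set Ω} (hA : MeasurableSet[m] A) :
    ∫ ω in A, (if J ω ≤ X ω then U ω else V ω) ∂P
      = ∫ ω in A, (X ω * U ω + (1 - X ω) * V ω) ∂P := by
  have hX' := hX.mono hm le_rfl
  have hU' := hU.mono hm le_rfl
  have hV' := hV.mono hm le_rfl
  have hD : Measurable[m] (A.indicator fun ω => U ω - V ω) := (hU.sub hV).indicator hA
  have hD' := hD.mono hm le_rfl
  have hVi : Integrable V P :=
    Integrable.of_bound hV'.aestronglyMeasurable C (ae_of_all _ hVC)
  have hUi : Integrable U P :=
    Integrable.of_bound hU'.aestronglyMeasurable C (ae_of_all _ hUC)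
  have hDi : Integrable (A.indicator fun ω => U ω - V ω) P := (hUi.sub hVi).indicator (hm _ hA)
  have hpair : IndepFun (fun ω => (X ω, A.indicator (fun ω => U ω - V ω) ω)) J P :=
    (IndepFun_iff_Indep _ _ _).2 (indep_of_indep_of_le_left hind
      (Measurable.comap_le (hX.prodMk hD)))
  have key := integral_ite_le_uniform hJ hunif hX' hD' hpair hX01 hDi
  have h1 : ∀ ω, (if J ω ≤ X ω then A.indicator (fun ω => U ω - V ω) ω else 0)
      = A.indicator (fun ω => (if J ω ≤ X ω then U ω - V ω else 0)) ω := by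
    intro ω; by_cases h : ω ∈ A <;> simp [h]
  have h2 : ∀ ω, X ω * A.indicator (fun ω => U ω - V ω) ω
      = A.indicator (fun ω => X ω * (U ω - V ω)) ω := by
    intro ω; by_cases h : ω ∈ A <;> simp [h]
  simp_rw [h1, h2] at key
  rw [integral_indicator (hm _ hA), integral_indicator (hm _ hA)] at key
  have i1 : IntegrableOn (fun ω => (if J ω ≤ X ω then U ω - V ω else 0)) A P := by
    refine Integrable.integrableOn ((hUi.sub hVi).mono ?_ (ae_of_all _ fun ω => ?_))
    · exact (Measurable.ite (measurableSet_le hJ hX') (hU'.sub hV')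
        measurable_const).aestronglyMeasurable
    · split_ifs <;> simp
  have i2 : IntegrableOn (fun ω => X ω * (U ω - V ω)) A P := by
    refine Integrable.integrableOn ((hUi.sub hVi).mono (hX'.mul (hU'.sub hV')).aestronglyMeasurable
      (ae_of_all _ fun ω => ?_))
    rw [norm_mul, Real.norm_eq_abs, abs_of_nonneg (hX01 ω).1]
    exact mul_le_of_le_one_left (norm_nonneg _) (hX01 ω).2
  have e1 : ∀ ω, (if J ω ≤ X ω then U ω else V ω)
      = (if J ω ≤ X ω then U ω - V ω else 0) + V ω := by
    intro ω; split_ifs <;> ring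
  have e2 : ∀ ω, X ω * U ω + (1 - X ω) * V ω = X ω * (U ω - V ω) + V ω := by intro ω; ring
  simp_rw [e1, e2]
  rw [integral_add i1 hVi.integrableOn, integral_add i2 hVi.integrableOn, key]

/-- Independent uniform variables fall infinitely often below thresholds of infinite sum. -/
lemma ae_frequently_le_of_uniform {J : ℕ → Ω → ℝ} (hJ : ∀ n, Measurable (J n))
    (hU : ∀ n, pdf.IsUniform (J n) (Set.Icc (0 : ℝ) 1) P volume) (hind : iIndepFun J P)
    {p : ℕ → ℝ} (hp : ∀ n, p n ∈ Set.Icc (0 : ℝ) 1)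
    (hsum : Tendsto (fun n => ∑ k ∈ Finset.range n, p k) atTop atTop) :
    ∀ᵐ ω ∂P, ∃ᶠ n in atTop, 0 < p n ∧ J n ω ≤ p n := by
  -- Removing `u ≤ 0` costs no probability and makes membership imply `0 < p n`.
  set s : ℕ → Set Ω := fun n => J n ⁻¹' Set.Ioc 0 (p n)
  have hsm : ∀ n, MeasurableSet (s n) := fun n => hJ n measurableSet_Ioc
  have hP : ∀ n, P (s n) = ENNReal.ofReal (p n) := by
    intro n
    rw [measure_preimage_of_isUniform_Icc (hU n) measurableSet_Ioc]
    have : Set.Icc (0 : ℝ) 1 ∩ Set.Ioc 0 (p n) = Set.Ioc 0 (p n) :=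
      Set.inter_eq_right.2 fun u hu => ⟨hu.1.le, hu.2.trans (hp n).2⟩
    rw [this, Real.volume_Ioc, sub_zero]
  have hs : iIndepSet s P := by
    rw [iIndepSet_iff_meas_biInter hsm]
    exact fun t => hind.meas_biInter fun i _ => ⟨_, measurableSet_Ioc, rfl⟩
  have hs' : ∑' n, P (s n) = ⊤ := by
    simp_rw [hP]
    by_contra h
    have h1 : Summable p := by
      have := ENNReal.summable_toReal h
      simpa [ENNReal.toReal_ofReal (hp _).1] using this
    exact not_tendsto_nhds_of_tendsto_atTop hsum _ h1.hasSum.tendsto_sum_nat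
  have h1 := measure_limsup_eq_one hsm hs hs'
  have h2 : ∀ᵐ ω ∂P, ω ∈ limsup s atTop := by
    have hms : MeasurableSet (limsup s atTop) := MeasurableSet.measurableSet_limsup hsm
    exact (prob_compl_eq_zero_iff hms).2 h1
  filter_upwards [h2] with ω hω
  rw [mem_limsup_iff_frequently_mem] at hω
  exact hω.mono fun n hn => ⟨hn.1.trans_le hn.2, hn.2⟩

/-- The information carried by `I_1, …, I_n`. -/
def past (I : ℕ → Ω → ℝ) (hI : ∀ n, 1 ≤ n → Measurable (I n)) : Filtration ℕ mΩ where
  seq n := ⨆ i ∈ {i : ℕ | i < n}, MeasurableSpace.comap (I (i + 1)) inferInstance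
  mono' _ _ hmn := biSup_mono fun _ hi => lt_of_lt_of_le hi hmn
  le' _ := iSup₂_le fun i _ => (hI (i + 1) (by omega)).comap_le

variable {I : ℕ → Ω → ℝ} (hI : ∀ n, 1 ≤ n → Measurable (I n))

omit [IsProbabilityMeasure P] in
lemma indep_past (hind : iIndepFun (fun n : ℕ => I (n + 1)) P) (n : ℕ) :
    Indep (past I hI n) (MeasurableSpace.comap (I (n + 1)) inferInstance) P := by
  have h := indep_iSup_of_disjoint (m := fun i => MeasurableSpace.comap (I (i + 1)) inferInstance)
    (fun i => (hI (i + 1) (by omega)).comap_le) hind.iIndep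
    (S := {i : ℕ | i < n}) (T := {n}) (by simp)
  simpa [past] using h

lemma measurable_narendra_past {γ : ℕ → ℝ} {η : Arm → ℕ → ℝ}
    (hη : ∀ ℓ n, 1 ≤ n → η ℓ n = 0 ∨ η ℓ n = 1) (x : ℝ) (n : ℕ) :
    Measurable[past I hI n] fun ω => narendra γ η x (fun k => I k ω) n := by
  induction n with
  | zero => exact measurable_const
  | succ n ih =>
    have h1 : Measurable[past I hI (n + 1)] fun ω => narendra γ η x (fun k => I k ω) n :=
      ih.mono ((past I hI).mono (Nat.le_succ n)) le_rfl
    have h2 : Measurable[past I hI (n + 1)] (I (n + 1)) :=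
      Measurable.of_comap_le (le_iSup₂_of_le (f := fun (i : ℕ) (_ : i ∈ {i : ℕ | i < n + 1}) =>
        MeasurableSpace.comap (I (i + 1)) inferInstance) n (Nat.lt_succ_self n) le_rfl)
    simp_rw [narendra_succ hη]
    refine Measurable.ite (measurableSet_le h2 h1) ?_ ?_
    · exact h1.add (measurable_const.mul (measurable_const.sub h1))
    · exact h1.sub (measurable_const.mul h1)

end Uniform

/-! ### Almost sure limits of bandit processes -/

/-- A filtration seen from time `N` on. -/
def shiftFiltration {Ω : Type*} {mΩ : MeasurableSpace Ω} (F : Filtration ℕ mΩ) (N : ℕ) :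
    Filtration ℕ mΩ where
  seq n := F (N + n)
  mono' _ _ h := F.mono (by omega)
  le' _ := F.le _

/-- A `(0,1)`-valued adapted process that follows, in conditional mean, the updating rule with
steps `γ` and payoffs `a`, `b`; `r` compensates the fluctuations of `a - b` around `d`. -/
structure BanditProcess {Ω : Type*} [mΩ : MeasurableSpace Ω] (P : Measure Ω)
    (F : Filtration ℕ mΩ) (X : ℕ → Ω → ℝ) (γ a b : ℕ → ℝ) (d : ℝ) (r : ℕ → ℝ) : Prop where
  step_mem : ∀ n, 1 ≤ n → γ n ∈ Set.Ioo (0 : ℝ) 1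
  payoff_left : ∀ n, 1 ≤ n → a n = 0 ∨ a n = 1
  payoff_right : ∀ n, 1 ≤ n → b n = 0 ∨ b n = 1
  gap_mem : d ∈ Set.Ioo (0 : ℝ) 1
  adapted : ∀ n, Measurable[F n] (X n)
  mem_Ioo : ∀ n ω, X n ω ∈ Set.Ioo (0 : ℝ) 1
  -- The Markov transition tested on past events; it is used with `f` the corrected state and with
  -- `f` its exponential.
  setIntegral_succ : ∀ n (A : Set Ω), MeasurableSet[F n] A → ∀ f : ℝ → ℝ, Continuous f →
    ∫ ω in A, f (X (n + 1) ω) ∂P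
      = ∫ ω in A, (X n ω * f (X n ω + γ (n + 1) * a (n + 1) * (1 - X n ω))
        + (1 - X n ω) * f (X n ω - γ (n + 1) * b (n + 1) * X n ω)) ∂P
  corrector_succ : ∀ n, r n = r (n + 1) + γ (n + 1) * (a (n + 1) - b (n + 1) - d)
  corrector_tendsto : Tendsto r atTop (𝓝 0)

namespace BanditProcess

variable {Ω : Type*} [mΩ : MeasurableSpace Ω] {P : Measure Ω} [IsProbabilityMeasure P]
  {F : Filtration ℕ mΩ} {X : ℕ → Ω → ℝ} {γ a b : ℕ → ℝ} {d : ℝ} {r : ℕ → ℝ}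
  (h : BanditProcess P F X γ a b d r)
include h

omit [IsProbabilityMeasure P] in
lemma measurable (n : ℕ) : Measurable (X n) := (h.adapted n).mono (F.le n) le_rfl

omit [IsProbabilityMeasure P] in
lemma mem_Icc (n : ℕ) (ω : Ω) : X n ω ∈ Set.Icc (0 : ℝ) 1 := Set.Ioo_subset_Icc_self (h.mem_Ioo n ω)

lemma integrable_comp {f : ℝ → ℝ} (hf : Continuous f) (n : ℕ) :
    Integrable (fun ω => f (X n ω)) P := by
  obtain ⟨C, hC⟩ := isCompact_Icc.exists_bound_of_continuousOn (s := Set.Icc (0 : ℝ) 1)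
    hf.continuousOn
  exact Integrable.of_bound (hf.measurable.comp (h.measurable n)).aestronglyMeasurable C
    (ae_of_all _ fun ω => hC _ (h.mem_Icc n ω))

omit [IsProbabilityMeasure P] in
lemma eventually_corrector_le : ∃ N, ∀ n, N ≤ n → |r n| ≤ d / 4 := by
  have := h.corrector_tendsto.abs
  rw [abs_zero] at this
  exact eventually_atTop.1 ((this.eventually (gt_mem_nhds (by linarith [h.gap_mem.1] :
    (0 : ℝ) < d / 4))).mono fun _ => le_of_lt)

lemma setIntegral_corrected_le {N : ℕ} (hN : ∀ n, N ≤ n → |r n| ≤ d / 4) {n : ℕ} (hn : N ≤ n)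
    {A : Set Ω} (hA : MeasurableSet[F n] A) :
    ∫ ω in A, corrected (r n) (X n ω) ∂P
      + d / 2 * (γ (n + 1) * ∫ ω in A, X n ω * (1 - X n ω) ∂P)
      ≤ ∫ ω in A, corrected (r (n + 1)) (X (n + 1) ω) ∂P := by
  rw [h.setIntegral_succ n A hA _ (continuous_corrected _), ← integral_const_mul,
    ← integral_const_mul, ← integral_add]
  · refine setIntegral_mono ?_ ?_ fun ω => ?_
    · exact (h.integrable_comp (f := fun X => corrected (r n) X
        + d / 2 * (γ (n + 1) * (X * (1 - X)))) (by
          have := continuous_corrected (r n); fun_prop) n).integrableOn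
    · have := continuous_corrected (r (n + 1))
      exact (h.integrable_comp (f := fun X => X * corrected (r (n + 1))
        (X + γ (n + 1) * a (n + 1) * (1 - X)) + (1 - X) * corrected (r (n + 1))
        (X - γ (n + 1) * b (n + 1) * X)) (by fun_prop) n).integrableOn
    · simp only [h.corrector_succ n]
      exact corrected_drift (h.step_mem _ (by omega)) (h.payoff_left _ (by omega))
        (h.payoff_right _ (by omega)) (hN _ (by omega)) (h.mem_Ioo n ω) h.gap_mem.1
  · exact (h.integrable_comp (continuous_corrected _) n).integrableOn
  · exact (h.integrable_comp (f := fun X => d / 2 * (γ (n + 1) * (X * (1 - X))))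
      (by fun_prop) n).integrableOn

lemma setIntegral_exp_corrected_le {N : ℕ} (hN : ∀ n, N ≤ n → |r n| ≤ d / 4) {n : ℕ} (hn : N ≤ n)
    {A : Set Ω} (hA : MeasurableSet[F n] A) {l : ℝ} (hl : 0 ≤ l) (hlg : l * γ (n + 1) ≤ d / 64) :
    ∫ ω in A, Real.exp (-l * corrected (r (n + 1)) (X (n + 1) ω)) ∂P
      ≤ ∫ ω in A, Real.exp (-l * corrected (r n) (X n ω)) ∂P := by
  have h1 := continuous_corrected (r (n + 1))
  have h2 := continuous_corrected (r n)
  rw [h.setIntegral_succ n A hA (fun y => Real.exp (-l * corrected (r (n + 1)) y)) (by fun_prop)]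
  refine setIntegral_mono ?_ ?_ fun ω => ?_
  · exact (h.integrable_comp (f := fun X => X * Real.exp (-l * corrected (r (n + 1))
        (X + γ (n + 1) * a (n + 1) * (1 - X))) + (1 - X) * Real.exp (-l * corrected (r (n + 1))
        (X - γ (n + 1) * b (n + 1) * X))) (by fun_prop) n).integrableOn
  · exact (h.integrable_comp (f := fun X => Real.exp (-l * corrected (r n) X))
      (by fun_prop) n).integrableOn
  · simp only [h.corrector_succ n]
    exact exp_corrected_drift (h.step_mem _ (by omega)) (h.payoff_left _ (by omega))
        (h.payoff_right _ (by omega)) h.gap_mem (hN _ (by omega)) (h.mem_Ioo n ω) hl hlg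

omit [IsProbabilityMeasure P] in
lemma abs_corrected_le {N : ℕ} (hN : ∀ n, N ≤ n → |r n| ≤ d / 4) {n : ℕ} (hn : N ≤ n) (ω : Ω) :
    |corrected (r n) (X n ω)| ≤ 2 :=
  _root_.abs_corrected_le ((hN n hn).trans (by linarith [h.gap_mem.2])) (h.mem_Icc n ω)

omit [IsProbabilityMeasure P] in
lemma tendsto_corrector_mul (ω : Ω) :
    Tendsto (fun n => r n * (X n ω * (1 - X n ω))) atTop (𝓝 0) := by
  have h0 := h.corrector_tendsto.abs
  rw [abs_zero] at h0
  refine squeeze_zero_norm (fun n => ?_) h0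
  obtain ⟨h1, h2⟩ := h.mem_Ioo n ω
  rw [norm_mul, Real.norm_eq_abs, Real.norm_eq_abs]
  refine mul_le_of_le_one_right (abs_nonneg _) ?_
  rw [abs_le]; constructor <;> nlinarith

/-- Once `|r| ≤ d/4`, the corrected state is a bounded submartingale, hence convergent; the
correction itself vanishes. -/
lemma ae_exists_tendsto : ∀ᵐ ω ∂P, ∃ c, Tendsto (fun n => X n ω) atTop (𝓝 c) := by
  obtain ⟨N, hN⟩ := h.eventually_corrector_le
  have hsub : Submartingale (fun n ω => corrected (r (N + n)) (X (N + n) ω))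
      (shiftFiltration F N) P := by
    refine submartingale_of_setIntegral_le_succ (fun n => ?_)
      (fun n => h.integrable_comp (continuous_corrected _) _) fun n A hA => ?_
    · exact ((continuous_corrected _).measurable.comp (h.adapted (N + n))).stronglyMeasurable
    · refine le_trans ?_ (h.setIntegral_corrected_le hN (by omega : N ≤ N + n) hA)
      refine le_add_of_nonneg_right (mul_nonneg (by linarith [h.gap_mem.1])
        (mul_nonneg (h.step_mem _ (by omega)).1.le (integral_nonneg fun ω => ?_)))
      obtain ⟨h1, h2⟩ := h.mem_Ioo (N + n) ω
      exact mul_nonneg h1.le (by linarith)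
  have hbdd : ∀ n, eLpNorm (fun ω => corrected (r (N + n)) (X (N + n) ω)) 1 P ≤ (2 : NNReal) := by
    intro n
    refine (eLpNorm_le_of_ae_bound (C := 2)
      (ae_of_all _ fun ω => h.abs_corrected_le hN (by omega) ω)).trans ?_
    simp
  filter_upwards [hsub.exists_ae_tendsto_of_bdd hbdd] with ω ⟨c, hc⟩
  refine ⟨c, (tendsto_add_atTop_iff_nat N).1 ?_⟩
  have h1 := hc.sub ((tendsto_add_atTop_iff_nat N).2 (h.tendsto_corrector_mul ω))
  rw [sub_zero] at h1
  refine h1.congr fun n => ?_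
  rw [add_comm N n, corrected]; ring

/-- The process converges almost surely to `0` or `1`. -/
lemma ae_tendsto_zero_or_one (hΓ : Tendsto (stepSum γ) atTop atTop) :
    ∀ᵐ ω ∂P, Tendsto (fun n => X n ω) atTop (𝓝 0) ∨ Tendsto (fun n => X n ω) atTop (𝓝 1) := by
  obtain ⟨N, hN⟩ := h.eventually_corrector_le
  obtain ⟨Y, hYm, hY⟩ := measurable_limit_of_tendsto_metrizable_ae
    (fun n => (h.measurable n).aemeasurable) h.ae_exists_tendsto
  set e : ℕ → ℝ := fun n => ∫ ω, X n ω * (1 - X n ω) ∂P with he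
  have hbd : ∀ n ω, |X n ω * (1 - X n ω)| ≤ 1 := fun n ω => by
    obtain ⟨h1, h2⟩ := h.mem_Ioo n ω
    rw [abs_le]; constructor <;> nlinarith
  have he0 : ∀ n, 0 ≤ e n := fun n => integral_nonneg fun ω => by
    obtain ⟨h1, h2⟩ := h.mem_Ioo n ω
    exact mul_nonneg h1.le (by linarith)
  have hlim : Tendsto e atTop (𝓝 (∫ ω, Y ω * (1 - Y ω) ∂P)) := by
    refine tendsto_integral_of_dominated_convergence (fun _ => 1)
      (fun n => ((h.measurable n).mul (measurable_const.sub (h.measurable n))).aestronglyMeasurable)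
      (integrable_const _) (fun n => ae_of_all _ (hbd n)) ?_
    filter_upwards [hY] with ω hω
    exact hω.mul (hω.const_sub 1)
  have hmean : ∀ n, N ≤ n → ∫ ω, corrected (r n) (X n ω) ∂P + d / 2 * (γ (n + 1) * e n)
      ≤ ∫ ω, corrected (r (n + 1)) (X (n + 1) ω) ∂P := by
    intro n hn
    have := h.setIntegral_corrected_le hN hn MeasurableSet.univ
    simpa using this
  have hB : ∀ n, N ≤ n → |∫ ω, corrected (r n) (X n ω) ∂P| ≤ 2 := by
    intro n hn
    have := norm_integral_le_of_norm_le_const (μ := P) (C := 2)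
      (f := fun ω => corrected (r n) (X n ω)) (ae_of_all _ fun ω => h.abs_corrected_le hN hn ω)
    simpa using this
  have hd := h.gap_mem.1
  -- If `E[X_n(1-X_n)]` had a positive limit `v`, the mean of the corrected state would grow at
  -- least like `(d v/4) Γ_n`, although it stays in `[-2, 2]`.
  have hzero : ∫ ω, Y ω * (1 - Y ω) ∂P = 0 := by
    by_contra hne
    have hpos : 0 < ∫ ω, Y ω * (1 - Y ω) ∂P :=
      lt_of_le_of_ne (ge_of_tendsto' hlim he0) (Ne.symm hne)
    set v := ∫ ω, Y ω * (1 - Y ω) ∂P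
    obtain ⟨M, hM⟩ := eventually_atTop.1 (hlim.eventually (lt_mem_nhds (half_lt_self hpos)))
    have hgrow : ∀ k, ∫ ω, corrected (r (max N M)) (X (max N M) ω) ∂P
        + d / 2 * (v / 2) * (stepSum γ (max N M + k) - stepSum γ (max N M))
        ≤ ∫ ω, corrected (r (max N M + k)) (X (max N M + k) ω) ∂P := by
      intro k
      induction k with
      | zero => simp
      | succ k ih =>
        have h1 := hmean (max N M + k) (by omega)
        have h2 := hM (max N M + k) (by omega)
        have h3 := (h.step_mem (max N M + k + 1) (by omega)).1
        have h4 : d / 2 * (γ (max N M + k + 1) * (v / 2))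
            ≤ d / 2 * (γ (max N M + k + 1) * e (max N M + k)) := by gcongr
        rw [← add_assoc, stepSum_succ]
        linarith
    have htop : Tendsto (fun k => d / 2 * (v / 2)
        * (stepSum γ (max N M + k) - stepSum γ (max N M))) atTop atTop := by
      refine Tendsto.const_mul_atTop (by positivity) (tendsto_atTop_add_const_right _ _ ?_)
      exact hΓ.comp (tendsto_atTop_mono (fun k => Nat.le_add_left k _) tendsto_id)
    obtain ⟨k, hk⟩ := (htop.eventually (eventually_gt_atTop 4)).exists
    have h1 := (abs_le.1 (hB (max N M) (le_max_left _ _))).1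
    have h2 := (abs_le.1 (hB (max N M + k) (by omega))).2
    linarith [hgrow k]
  have hY01 : ∀ᵐ ω ∂P, Y ω ∈ Set.Icc (0 : ℝ) 1 := by
    filter_upwards [hY] with ω hω
    exact isClosed_Icc.mem_of_tendsto hω (Eventually.of_forall fun n => h.mem_Icc n ω)
  have hYi : Integrable (fun ω => Y ω * (1 - Y ω)) P := by
    refine Integrable.of_bound (hYm.mul (measurable_const.sub hYm)).aestronglyMeasurable 1 ?_
    filter_upwards [hY01] with ω ⟨h1, h2⟩
    rw [Real.norm_eq_abs, abs_le]; constructor <;> nlinarith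
  have hYnn : 0 ≤ᵐ[P] fun ω => Y ω * (1 - Y ω) := by
    filter_upwards [hY01] with ω ⟨h1, h2⟩
    exact mul_nonneg h1 (by linarith)
  filter_upwards [hY, (integral_eq_zero_iff_of_nonneg_ae hYnn hYi).1 hzero] with ω h1 h2
  rcases mul_eq_zero.1 h2 with h3 | h3
  · left; rwa [h3] at h1
  · right; rwa [← (sub_eq_zero.1 h3)] at h1

omit [IsProbabilityMeasure P] in
lemma measurableSet_tendsto_zero :
    MeasurableSet[⨆ n, F n] {ω | Tendsto (fun n => X n ω) atTop (𝓝 0)} :=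
  @measurableSet_tendsto _ _ _ (⨆ n, F n) _ _ atTop _ (𝓝 0) _ _ _
    fun n => (h.adapted n).mono (le_iSup (fun n => F n) n) le_rfl

omit [IsProbabilityMeasure P] in
lemma measurableSet_tendsto_zero' : MeasurableSet {ω | Tendsto (fun n => X n ω) atTop (𝓝 0)} :=
  iSup_le (fun n => F.le n) _ h.measurableSet_tendsto_zero

omit [IsProbabilityMeasure P] in
lemma tendsto_corrected {ω : Ω} {c : ℝ} (hc : Tendsto (fun n => X n ω) atTop (𝓝 c)) :
    Tendsto (fun n => corrected (r n) (X n ω)) atTop (𝓝 c) := by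
  have := hc.add (h.tendsto_corrector_mul ω)
  rwa [add_zero] at this

/-- From a state at least as large as the step, the limit `0` is not conditionally certain. -/
lemma measureReal_inter_tendsto_zero_le (hΓ : Tendsto (stepSum γ) atTop atTop)
    (hS : AntitoneOn γ (Set.Ici 1)) {N : ℕ} (hN : ∀ n, N ≤ n → |r n| ≤ d / 4) {n : ℕ}
    (hn : N ≤ n) (hn1 : 1 ≤ n) {A : Set Ω} (hA : MeasurableSet[F n] A)
    (hAX : ∀ ω ∈ A, γ n ≤ X n ω) :
    P.real (A ∩ {ω | Tendsto (fun n => X n ω) atTop (𝓝 0)})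
      ≤ Real.exp (-(d / 128)) * P.real A := by
  have hg := (h.step_mem n hn1).1
  have hd := h.gap_mem
  -- The largest parameter with `l γ_k ≤ d/64` for all `k > n` that monotonicity of `γ` guarantees.
  set l := d / 64 / γ n with hl
  have hl0 : 0 ≤ l := div_nonneg (by linarith [hd.1]) hg.le
  set B := {ω | Tendsto (fun n => X n ω) atTop (𝓝 0)} with hB
  have hBm : MeasurableSet B := h.measurableSet_tendsto_zero'
  have hAm := F.le n _ hA
  set Z : ℕ → Ω → ℝ := fun k ω => Real.exp (-l * corrected (r k) (X k ω)) with hZ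
  have hmono : ∀ k, ∫ ω in A, Z (n + k) ω ∂P ≤ ∫ ω in A, Z n ω ∂P := by
    intro k
    induction k with
    | zero => rfl
    | succ k ih =>
      refine (h.setIntegral_exp_corrected_le hN (by omega : N ≤ n + k)
        (F.mono (Nat.le_add_right n k) _ hA) hl0 ?_).trans ih
      have : γ (n + k + 1) ≤ γ n := hS (Set.mem_Ici.2 hn1) (Set.mem_Ici.2 (by omega)) (by omega)
      calc l * γ (n + k + 1) ≤ l * γ n := by gcongr
        _ = d / 64 := by rw [hl]; field_simp
  have hZm : ∀ k, Measurable (Z k) := fun k =>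
    (Real.measurable_exp.comp (((continuous_corrected _).measurable.comp
      (h.measurable k)).const_mul _))
  set L : Ω → ℝ := fun ω => B.indicator (fun _ => 1) ω with hL
  have hLlim : ∫ ω in A, L ω ∂P ≤ ∫ ω in A, Z n ω ∂P := by
    -- Almost surely the exponential tends to 1 on `B` and to `e^{-l}` off `B`.
    have hlim : Tendsto (fun k => ∫ ω in A, Z (n + k) ω ∂P) atTop
        (𝓝 (∫ ω in A, (B.indicator (fun _ => 1) ω
          + Bᶜ.indicator (fun _ => Real.exp (-l * 1)) ω) ∂P)) := by
      refine tendsto_integral_of_dominated_convergence (fun _ => Real.exp (l * 2))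
        (fun k => (hZm _).aestronglyMeasurable) (integrable_const _) (fun k => ae_of_all _ fun ω => ?_)
        (ae_restrict_of_ae ?_)
      · have := (abs_le.1 (h.abs_corrected_le hN (by omega : N ≤ n + k) ω)).1
        rw [Real.norm_eq_abs, abs_of_pos (Real.exp_pos _), Real.exp_le_exp]
        nlinarith
      · filter_upwards [h.ae_tendsto_zero_or_one hΓ] with ω hω
        have hsh : ∀ {c : ℝ}, Tendsto (fun n => X n ω) atTop (𝓝 c) →
            Tendsto (fun k => Z (n + k) ω) atTop (𝓝 (Real.exp (-l * c))) := fun hc => by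
          have h1 := (Real.continuous_exp.tendsto _).comp ((h.tendsto_corrected hc).const_mul (-l))
          exact h1.comp (tendsto_atTop_mono (fun k => Nat.le_add_left k _) tendsto_id)
        by_cases hωB : ω ∈ B
        · have := hsh hωB
          simpa [hωB] using this
        · have := hsh (hω.resolve_left hωB)
          simpa [hωB] using this
    refine le_trans ?_ (le_of_tendsto' hlim hmono)
    have i1 : Integrable (B.indicator fun _ => (1 : ℝ)) (P.restrict A) :=
      (integrable_const _).indicator hBm
    have i2 : Integrable (Bᶜ.indicator fun _ => Real.exp (-l * 1)) (P.restrict A) :=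
      (integrable_const _).indicator hBm.compl
    refine integral_mono i1 (i1.add i2) fun ω => ?_
    exact le_add_of_nonneg_right (Set.indicator_nonneg (fun _ _ => (Real.exp_pos _).le) _)
  have hL1 : ∫ ω in A, L ω ∂P = P.real (A ∩ B) := by
    rw [hL, integral_indicator_const _ hBm, smul_eq_mul, mul_one, measureReal_restrict_apply hBm,
      Set.inter_comm]
  rw [← hL1]
  refine hLlim.trans ?_
  -- As `1 - d/4 ≥ 1/2`, the corrected state is at least `γ_n/2`, and `l γ_n/2 = d/128`.
  have hle : ∀ ω ∈ A, Z n ω ≤ Real.exp (-(d / 128)) := by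
    intro ω hω
    rw [hZ, Real.exp_le_exp]
    have h1 := le_corrected (hN n hn) (h.mem_Icc n ω)
    have h2 : γ n / 2 ≤ corrected (r n) (X n ω) := by
      nlinarith [hAX ω hω, (h.mem_Ioo n ω).1, hd.2]
    have h3 : l * (γ n / 2) ≤ l * corrected (r n) (X n ω) := by gcongr
    have h4 : l * (γ n / 2) = d / 128 := by rw [hl]; field_simp; ring
    linarith
  calc ∫ ω in A, Z n ω ∂P ≤ ∫ _ω in A, Real.exp (-(d / 128)) ∂P := by
        refine setIntegral_mono_on ?_ (integrable_const _) hAm hle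
        exact (h.integrable_comp (f := fun X => Real.exp (-l * corrected (r n) X)) (by
          have := continuous_corrected (r n); fun_prop) n).integrableOn
    _ = _ := by rw [setIntegral_const, smul_eq_mul, mul_comm]

/-- If the state is infinitely often at least as large as the step, the limit is `1`. -/
lemma ae_tendsto_one (hΓ : Tendsto (stepSum γ) atTop atTop) (hS : AntitoneOn γ (Set.Ici 1))
    (hfreq : ∀ᵐ ω ∂P, ∃ᶠ n in atTop, γ n ≤ X n ω) :
    ∀ᵐ ω ∂P, Tendsto (fun n => X n ω) atTop (𝓝 1) := by
  obtain ⟨N, hN⟩ := h.eventually_corrector_le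
  set B := {ω | Tendsto (fun n => X n ω) atTop (𝓝 0)} with hB
  have hBm : MeasurableSet B := h.measurableSet_tendsto_zero'
  set g : Ω → ℝ := B.indicator fun _ => 1 with hg
  have hgi : Integrable g P := (integrable_const _).indicator hBm
  set q := Real.exp (-(d / 128)) with hq
  have hq1 : q < 1 := by rw [hq, Real.exp_lt_one_iff]; linarith [h.gap_mem.1]
  have hcond : ∀ n, N ≤ n → 1 ≤ n → ∀ᵐ ω ∂P, γ n ≤ X n ω → (P[g | F n]) ω ≤ q := by
    intro n hn hn1
    -- The exceptional event lies in `F n`; integrating the conditional probability over it forces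
    -- it to be null.
    set A := {ω | γ n ≤ X n ω} ∩ {ω | q < (P[g | F n]) ω} with hAdef
    have hA : MeasurableSet[F n] A :=
      MeasurableSet.inter (h.adapted n measurableSet_Ici)
        (stronglyMeasurable_condExp.measurable measurableSet_Ioi)
    have hAm := F.le n _ hA
    have h1 := h.measureReal_inter_tendsto_zero_le hΓ hS hN hn hn1 hA fun ω hω => hω.1
    have h2 : ∫ ω in A, (P[g | F n]) ω ∂P = P.real (A ∩ B) := by
      rw [setIntegral_condExp (F.le n) hgi hA, hg, integral_indicator_const _ hBm, smul_eq_mul,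
        mul_one, measureReal_restrict_apply hBm, Set.inter_comm]
    have hci : Integrable (fun ω => (P[g | F n]) ω - q) P :=
      integrable_condExp.sub (integrable_const _)
    have h3 : ∫ ω in A, ((P[g | F n]) ω - q) ∂P ≤ 0 := by
      rw [integral_sub integrable_condExp.integrableOn (integrable_const _), h2, setIntegral_const,
        smul_eq_mul]
      linarith
    have hnn : 0 ≤ᵐ[P.restrict A] fun ω => (P[g | F n]) ω - q :=
      (ae_restrict_iff' hAm).2 (ae_of_all _ fun ω hω => (sub_pos.2 hω.2).le)
    have h4 := (setIntegral_eq_zero_iff_of_nonneg_ae hnn hci.integrableOn).1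
      (le_antisymm h3 (integral_nonneg_of_ae hnn))
    have h5 := (ae_restrict_iff' hAm).1 h4
    filter_upwards [h5] with ω hω hX
    by_contra hlt
    have hmem : ω ∈ A := ⟨hX, not_le.1 hlt⟩
    have := hω hmem
    simp only [Pi.zero_apply] at this
    linarith [not_le.1 hlt]
  have hall : ∀ᵐ ω ∂P, ∀ n, N ≤ n → 1 ≤ n → γ n ≤ X n ω → (P[g | F n]) ω ≤ q := by
    rw [ae_all_iff]; intro n
    by_cases hn : N ≤ n ∧ 1 ≤ n
    · filter_upwards [hcond n hn.1 hn.2] with ω hω _ _ using hω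
    · exact ae_of_all _ fun ω h1 h2 => absurd ⟨h1, h2⟩ hn
  have hgm : StronglyMeasurable[⨆ n, F n] g :=
    stronglyMeasurable_const.indicator h.measurableSet_tendsto_zero
  have hcond_eq : P[g | ⨆ n, F n] = g :=
    condExp_of_stronglyMeasurable (iSup_le fun n => F.le n) hgm hgi
  -- On `B` the conditional probabilities tend to 1, which is incompatible with being at most `q`
  -- infinitely often.
  have hlevy := tendsto_ae_condExp (μ := P) (ℱ := F) g
  rw [hcond_eq] at hlevy
  filter_upwards [hall, hlevy, hfreq, h.ae_tendsto_zero_or_one hΓ] with ω h1 h2 h3 h4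
  refine h4.resolve_left fun h0 => ?_
  have hg1 : g ω = 1 := by simp [hg, hB, h0]
  rw [hg1] at h2
  obtain ⟨n, hn, hn'⟩ := (h3.and_eventually ((h2.eventually (lt_mem_nhds hq1)).and
    ((eventually_ge_atTop N).and (eventually_ge_atTop 1)))).exists
  exact absurd (h1 n hn'.2.1 hn'.2.2 hn) (not_le.2 hn'.1)

end BanditProcess

/-! ### Infallibility of the Narendra algorithm -/

theorem theorem2 {Ω : Type*} [MeasurableSpace Ω] (P : Measure Ω) [IsProbabilityMeasure P]
    (γ : ℕ → ℝ) (hγ : ∀ n, 1 ≤ n → γ n ∈ Set.Ioo (0 : ℝ) 1)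
    (η : Arm → ℕ → ℝ) (hη : ∀ ℓ n, 1 ≤ n → η ℓ n = 0 ∨ η ℓ n = 1)
    (θ : Arm → ℝ) (hθ : ∀ ℓ, θ ℓ ∈ Set.Ioo (0 : ℝ) 1)
    (x : ℝ) (hx : x ∈ Set.Ioo (0 : ℝ) 1)
    (I : ℕ → Ω → ℝ) (hI_meas : ∀ n, 1 ≤ n → Measurable (I n))
    (hI_unif : ∀ n, 1 ≤ n → pdf.IsUniform (I n) (Set.Icc (0 : ℝ) 1) P volume)
    (hI_indep : iIndepFun (fun n : ℕ => I (n + 1)) P)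
    (hS1 : StepCond1 γ) (hS2 : StepCond2 γ (θ Arm.B))
    (hE2 : ErgodicCond2 η θ) (hAB : θ Arm.B < θ Arm.A) :
    ∀ᵐ ω ∂P, Tendsto (fun n => narendra γ η x (fun k => I k ω) n) atTop (𝓝 1) := by
  have hB := (hθ Arm.B).1
  obtain ⟨K, hK, hexp⟩ := hS2.exists_exp_bound hB hγ
  obtain ⟨C, hC, hlog⟩ := exists_stepSum_le_log (half_pos hB) hK hexp
  obtain ⟨ε, hε, K', hK', hdev⟩ := hE2.exists_bound
  have hconv : ∀ ℓ, ∃ T, Tendsto (fun n => ∑ k ∈ Finset.Icc 1 n, γ k * (η ℓ k - θ ℓ)) atTop (𝓝 T) :=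
    fun ℓ => exists_tendsto_sum_mul hγ hS1.1 hε hC hK' hlog (hdev ℓ)
  choose T hT using hconv
  set d := θ Arm.A - θ Arm.B with hd
  set S : Arm → ℕ → ℝ := fun ℓ n => ∑ k ∈ Finset.Icc 1 n, γ k * (η ℓ k - θ ℓ) with hS
  -- The tail after `n` of `∑ γ_k (η_{A,k} - η_{B,k} - d)`, so that `r_n - r_{n+1}` is its next
  -- term.
  set r : ℕ → ℝ := fun n => (T Arm.A - S Arm.A n) - (T Arm.B - S Arm.B n) with hr
  set X : ℕ → Ω → ℝ := fun n ω => narendra γ η x (fun k => I k ω) n with hX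
  have hX01 : ∀ n ω, X n ω ∈ Set.Ioo (0 : ℝ) 1 := fun n ω => narendra_mem_Ioo hγ hη hx _ n
  have hproc : BanditProcess P (past I hI_meas) X γ (η Arm.A) (η Arm.B) d r :=
    { step_mem := hγ
      payoff_left := hη Arm.A
      payoff_right := hη Arm.B
      gap_mem := ⟨sub_pos.2 hAB, by linarith [(hθ Arm.A).2]⟩
      adapted := measurable_narendra_past hI_meas hη x
      mem_Ioo := hX01
      setIntegral_succ := by
        intro n A hA f hf
        obtain ⟨M, hM⟩ := isCompact_Icc.exists_bound_of_continuousOn (s := Set.Icc (0 : ℝ) 1)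
          hf.continuousOn
        have hXm := measurable_narendra_past hI_meas hη (γ := γ) x n
        have hg := hγ (n + 1) (by omega)
        have hmem : ∀ ω, X n ω + γ (n + 1) * η Arm.A (n + 1) * (1 - X n ω) ∈ Set.Icc (0 : ℝ) 1 ∧
            X n ω - γ (n + 1) * η Arm.B (n + 1) * X n ω ∈ Set.Icc (0 : ℝ) 1 := by
          intro ω
          obtain ⟨h0, h1⟩ := hX01 n ω
          obtain ⟨g0, g1⟩ := hg
          rcases hη Arm.A (n + 1) (by omega) with h | h <;>
          rcases hη Arm.B (n + 1) (by omega) with h' | h' <;> rw [h, h'] <;>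
          refine ⟨⟨?_, ?_⟩, ?_, ?_⟩ <;> nlinarith
        refine Eq.trans ?_ (setIntegral_ite_le_uniform ((past I hI_meas).le n) (hI_meas (n + 1) (by omega))
          (hI_unif (n + 1) (by omega)) (indep_past hI_meas hI_indep n) hXm
          (hf.measurable.comp (hXm.add (measurable_const.mul (measurable_const.sub hXm))))
          (hf.measurable.comp (hXm.sub (measurable_const.mul hXm)))
          (fun ω => Set.Ioo_subset_Icc_self (hX01 n ω)) (fun ω => hM _ (hmem ω).1)
          (fun ω => hM _ (hmem ω).2) hA)
        refine integral_congr_ae (ae_of_all _ fun ω => ?_)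
        simp only [hX, narendra_succ hη, Function.comp]
        split_ifs <;> rfl
      corrector_succ := by
        intro n
        simp only [hr, hS, Finset.sum_Icc_succ_top (by omega : 1 ≤ n + 1), hd]
        ring
      corrector_tendsto := by
        have := ((hT Arm.A).const_sub (T Arm.A)).sub ((hT Arm.B).const_sub (T Arm.B))
        simpa using this }
  refine hproc.ae_tendsto_one hS1.2 hS1.1 ?_
  obtain ⟨M, hM⟩ := (hT Arm.B).bddAbove_range
  obtain ⟨c, ⟨hc0, hc1⟩, hlow⟩ := exists_exp_le_narendra hγ hη hx hS1.1
    (sum_sq_step_le hγ (half_pos hB) hK hexp) (fun n => hM ⟨n, rfl⟩)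
  have hdiv := (tendsto_sum_exp_neg_stepSum_mul hB hγ hS1 hS2 hE2 (ℓ := Arm.A)
    (hθ Arm.A).1).const_mul_atTop hc0
  have hfreq := ae_frequently_le_of_uniform (fun n => hI_meas (n + 1) (by omega))
    (fun n => hI_unif (n + 1) (by omega)) hI_indep
    -- The factor `η_A` makes the event `0 < p n`, `I_{n+1} ≤ p n` force that A is played and pays.
    (p := fun n => c * (Real.exp (-θ Arm.B * stepSum γ n) * η Arm.A (n + 1))) (fun n => ?_)
    (by simpa only [Finset.mul_sum] using hdiv)
  · filter_upwards [hfreq] with ω hω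
    rw [frequently_atTop] at hω ⊢
    intro m
    obtain ⟨n, hn, hpos, hle⟩ := hω m
    refine ⟨n + 1, by omega, ?_⟩
    rcases hη Arm.A (n + 1) (by omega) with h | h
    · simp [h] at hpos
    · rw [h, mul_one] at hle
      -- After a success of A, `X_{n+1} = γ_{n+1} + (1 - γ_{n+1}) X_n ≥ γ_{n+1}`.
      have hplay := hle.trans (hlow (fun k => I k ω) n)
      simp only [hX]
      rw [narendra_succ hη, if_pos hplay, h]
      have := (hX01 n ω).1
      have hg := hγ (n + 1) (by omega)
      simp only [hX] at this
      nlinarith [hg.1, hg.2]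
  · have hE : Real.exp (-θ Arm.B * stepSum γ n) ≤ 1 := by
      rw [Real.exp_le_one_iff]; nlinarith [stepSum_nonneg hγ n]
    have hE0 := Real.exp_pos (-θ Arm.B * stepSum γ n)
    rcases hη Arm.A (n + 1) (by omega) with h | h <;> rw [h]
    · simp
    · rw [mul_one]
      exact ⟨by positivity, by nlinarith⟩
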